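/- **Spectral Theorem (bounded operators, complex case).** Let $H$ be a complex Hilbert space, $d\in\mathbb N$, and let $A_1,\dots,A_d$ be bounded, normal, pairwise commuting operators on $H$. Then there is a unique Borel calculus $(\Phi,H)$ on $\mathbb C^d$ such that $\Phi(\mathbf z_j)=A_j$ for all $j=1,\dots,d$, where $\mathbf z_j:\mathbb C^d\to\mathbb C$ denotes the $j$-th coordinate function. Here a *Borel calculus* $(\Phi,H)$ on a topological space $X$ is a map $\Phi:\mathcal M(X)\to\mathcal C(H)$, from the algebra $\mathcal M(X)$ of all (not necessarily bounded) Borel measurable functions $X\to\mathbb C$ into the set $\mathcal C(H)$ of all closed linear operators in $H$ (not necessarily bounded or everywhere defined), such that for all $f,g\in\mathcal M(X)$ and $\lambda\in\mathbb C$: 1. $\Phi(\mathbf 1)=\mathrm I$; 2. $\Phi(f)+\Phi(g)\subseteq\Phi(f+g)$ and $\lambda\Phi(f)\subseteq\Phi(\lambda f)$; 3. $\Phi(f)\Phi(g)\subseteq\Phi(fg)$ and $\operatorname{dom}(\Phi(f)\Phi(g))=\operatorname{dom}(\Phi(g))\cap\operatorname{dom}(\Phi(fg))$; 4. if $f$ is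 bounded, then $\Phi(f)$ is a bounded operator defined on all of $H$, and $\Phi(f)^*=\Phi(\overline f)$; 5. if $f_n,f\in\mathcal M(X)$ are such that $f_n\to f$ pointwise and $\sup_n\|f_n\|_\infty<\infty$, then $\Phi(f_n)\to\Phi(f)$ in the weak operator topology. Sums, scalar multiples and products of operators carry their natural (maximal) domains, and inclusions are inclusions of graphs. -/

import Mathlib

open Filter Topology

namespace MeasCalc

/-- The unital `*`-algebra `M(X, Σ)` of all measurable functions `X → ℂ` (bounded or not), with
pointwise operations. -/
def MeasFun (X : Type*) [MeasurableSpace X] : StarSubalgebra ℂ (X → ℂ) where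
  carrier := {f | Measurable f}
  mul_mem' hf hg := Measurable.mul hf hg
  add_mem' hf hg := Measurable.add hf hg
  algebraMap_mem' _ := measurable_const
  star_mem' hf := Complex.continuous_conj.measurable.comp hf

section Operators

variable {H : Type*} [NormedAddCommGroup H] [InnerProductSpace ℂ H]

/-- The product `A B` of two (unbounded) operators, `(A B) x = A (B x)`, on its maximal domain
`{x ∈ dom B | B x ∈ dom A}`. -/
def opMul (A B : H →ₗ.[ℂ] H) : H →ₗ.[ℂ] H :=
  A.comp (B.domRestrict ((A.domain.comap B.toFun).map B.domain.subtype)) (by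
    rintro ⟨x, hx⟩
    obtain ⟨⟨y, hyA, rfl⟩, hxB⟩ := hx
    exact hyA)

theorem mem_opMul_domain (A B : H →ₗ.[ℂ] H) (x : H) :
    x ∈ (opMul A B).domain ↔ ∃ hx : x ∈ B.domain, B ⟨x, hx⟩ ∈ A.domain := by
  constructor
  · rintro ⟨⟨y, hyA, rfl⟩, hxB⟩
    exact ⟨hxB, hyA⟩
  · rintro ⟨hx, h⟩
    exact ⟨⟨⟨x, hx⟩, h, rfl⟩, hx⟩

theorem opMul_apply (A B : H →ₗ.[ℂ] H) (x : H) (hx : x ∈ B.domain) (h : B ⟨x, hx⟩ ∈ A.domain) :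
    opMul A B ⟨x, (mem_opMul_domain A B x).2 ⟨hx, h⟩⟩ = A ⟨B ⟨x, hx⟩, h⟩ :=
  rfl

variable (H) in
/-- The set `C(H)` of all closed linear operators in `H` (closed graph in `H × H`; no density of
the domain is required). -/
def ClosedOp : Type _ := {A : H →ₗ.[ℂ] H // A.IsClosed}

/-- A bounded operator, viewed as a closed operator with domain `H`. -/
def ofBounded (T : H →L[ℂ] H) : ClosedOp H :=
  ⟨(T : H →ₗ[ℂ] H).toPMap ⊤, by
    have hg : (((T : H →ₗ[ℂ] H).toPMap ⊤).graph : Set (H × H)) = {p | T p.1 = p.2} := by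
      ext ⟨x, y⟩
      simp
    rw [LinearPMap.IsClosed, hg]
    exact isClosed_eq (T.continuous.comp continuous_fst) continuous_snd⟩

end Operators

/-- `Φ : M(X, Σ) → C(H)` is a measurable (functional) calculus on the measurable space `X`.
Inclusion `A ⊆ B` of operators is the order `A ≤ B` on `LinearPMap`. -/
structure IsMeasurableCalculus {X : Type*} [MeasurableSpace X]
    {H : Type*} [NormedAddCommGroup H] [InnerProductSpace ℂ H] [CompleteSpace H]
    (Φ : MeasFun X → ClosedOp H) : Prop where
  map_one : Φ 1 = ofBounded (ContinuousLinearMap.id ℂ H)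
  add_le : ∀ f g : MeasFun X, (Φ f).1 + (Φ g).1 ≤ (Φ (f + g)).1
  smul_le : ∀ (c : ℂ) (f : MeasFun X), c • (Φ f).1 ≤ (Φ (c • f)).1
  mul_le : ∀ f g : MeasFun X, opMul (Φ f).1 (Φ g).1 ≤ (Φ (f * g)).1
  mul_domain : ∀ f g : MeasFun X,
    (opMul (Φ f).1 (Φ g).1).domain = (Φ g).1.domain ⊓ (Φ (f * g)).1.domain
  /-- If `f` is bounded then `Φ f` is a bounded operator and its adjoint is `Φ` of the complex
  conjugate of `f`. -/
  bounded : ∀ f : MeasFun X, (∃ C : ℝ, ∀ x, ‖f.1 x‖ ≤ C) →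
    ∃ T : H →L[ℂ] H, Φ f = ofBounded T ∧ Φ (star f) = ofBounded (ContinuousLinearMap.adjoint T)
  /-- If `fₙ → f` pointwise and boundedly then `Φ fₙ → Φ f` in the weak operator topology. (By
  the field `bounded`, the operators `T n` and `S` below exist.) -/
  weak_bp : ∀ (f : ℕ → MeasFun X) (g : MeasFun X), (∃ C : ℝ, ∀ n x, ‖(f n).1 x‖ ≤ C) →
    (∀ x, Tendsto (fun n => (f n).1 x) atTop (𝓝 (g.1 x))) →
    ∀ (T : ℕ → H →L[ℂ] H) (S : H →L[ℂ] H), (∀ n, Φ (f n) = ofBounded (T n)) →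
      Φ g = ofBounded S →
      ∀ x y : H, Tendsto (fun n => inner ℂ (T n x) y) atTop (𝓝 (inner ℂ (S x) y))

/-- A Borel calculus is a measurable calculus on a topological space with its Borel
`σ`-algebra. -/
def IsBorelCalculus {X : Type*} [TopologicalSpace X] [MeasurableSpace X] [BorelSpace X]
    {H : Type*} [NormedAddCommGroup H] [InnerProductSpace ℂ H] [CompleteSpace H]
    (Φ : MeasFun X → ClosedOp H) : Prop :=
  IsMeasurableCalculus Φ

/-- The coordinate function `z_j` on `ℂ^d`. -/
def coord {d : ℕ} (j : Fin d) : MeasFun (Fin d → ℂ) :=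
  ⟨fun z => z j, show Measurable fun z : Fin d → ℂ => z j from measurable_pi_apply j⟩

end MeasCalc

/-! Existence. By Fuglede's theorem the `A j` and their adjoints generate a commutative C⋆-algebra.
Gelfand duality, transported along `χ ↦ (χ (A j))_j`, yields a compact `K ⊆ ℂ^d` and a
representation `ρ` of `C(K)` sending the coordinates to the `A j`. Riesz–Markov–Kakutani gives each
vector `x` a finite measure `μ_x` with `‖ρ φ x‖ = ‖φ‖` in `L²(μ_x)`, so `φ ↦ ρ φ x` extends
isometrically to `L²(μ_x)`. For Borel `f`, the operator `Φ f` is defined at `x` exactly when `f ∈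
L²(μ_x)`, and `Φ f x` is the image of `f`. If `y = Φ f x`, then `dμ_y = |f|² dμ_x`
(`MapsTo.spectralMeasure_eq`), which gives the product rule with its exact domain. Truncating `f`
gives closedness.

Uniqueness. The coordinates are unbounded on `ℂ^d`, so the adjoint axiom does not apply to them
directly. But if `Φ g` is bounded, then `Φ` kills the indicator of `{|g| > R}` for large `R`, whence
`Φ (star g) = (Φ g)*` (`apply_star_of_eq_ofBounded`). Therefore `Φ` sends `1 / (1 + |z_j|²)` to the
inverse of `1 + A_j* A_j`, and two calculi with the same `A j` agree on it and on `z_j / (1 +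
|z_j|²)`. These functions separate points, so the scalar measures of the two calculi coincide, and
with them the values on bounded functions. Truncation and closedness carry the equality to all
functions. -/

namespace MeasCalc

open MeasureTheory
open scoped NNReal ENNReal CompactlySupported BoundedContinuousFunction

/-! ### Scalar spectral measures of a representation of `C(K)`. -/

section SpectralMeasure

theorem eLpNorm_two_sq {α E : Type*} [MeasurableSpace α] [NormedAddCommGroup E] (f : α → E)
    (μ : Measure α) : eLpNorm f 2 μ ^ 2 = ∫⁻ a, ‖f a‖ₑ ^ 2 ∂μ := by
  have := eLpNorm_nnreal_pow_eq_lintegral (μ := μ) (f := f) (p := 2) (by norm_num)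
  simpa using this

theorem ennreal_eq_of_sq_eq {a b : ℝ≥0∞} (h : a ^ 2 = b ^ 2) : a = b :=
  (ENNReal.pow_right_strictMono two_ne_zero).injective h

variable {K : Type*} [MetricSpace K]
variable {H : Type*} [NormedAddCommGroup H] [InnerProductSpace ℂ H] [CompleteSpace H]

theorem re_inner_starMul (ρ : C(K, ℂ) →⋆ₐ[ℂ] (H →L[ℂ] H)) (φ : C(K, ℂ)) (x : H) :
    (inner ℂ x (ρ (star φ * φ) x)).re = ‖ρ φ x‖ ^ 2 := by
  rw [map_mul, map_star, ContinuousLinearMap.star_eq_adjoint, mul_apply_eq_comp,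
    ContinuousLinearMap.adjoint_inner_right, inner_self_eq_norm_sq_to_K]
  norm_cast

/-- The complex-valued continuous function underlying an `ℝ≥0`-valued one. -/
def nnrealToComplex (f : C_c(K, ℝ≥0)) : C(K, ℂ) :=
  ⟨fun k => ((f k : ℝ) : ℂ), by fun_prop⟩

variable [MeasurableSpace K] [BorelSpace K]

/-- A nonnegative continuous function is the square of its square root, so integrals of `|φ|²`
already determine a finite measure. -/
theorem measure_ext_of_lintegral_sq {μ ν : Measure K} [IsFiniteMeasure μ]
    (h : ∀ φ : C(K, ℂ), ∫⁻ k, ‖φ k‖ₑ ^ 2 ∂μ = ∫⁻ k, ‖φ k‖ₑ ^ 2 ∂ν) : μ = ν := by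
  refine ext_of_forall_lintegral_eq_of_IsFiniteMeasure fun f => ?_
  have key : ∀ k, (f k : ℝ≥0∞) = ‖((NNReal.sqrt (f k) : ℝ) : ℂ)‖ₑ ^ 2 := by
    intro k
    rw [enorm_eq_nnnorm, ← ENNReal.coe_pow]
    congr 1
    ext
    simp
  simp_rw [key]
  exact h ⟨fun k => ((NNReal.sqrt (f k) : ℝ) : ℂ), by fun_prop⟩

theorem exists_tendsto_eLpNorm_sub {μ : Measure K}
    [IsFiniteMeasure μ] [μ.WeaklyRegular] {f : K → ℂ} (hf : MemLp f 2 μ) :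
    ∃ φ : ℕ → C(K, ℂ), Tendsto (fun n => eLpNorm (f - ⇑(φ n)) 2 μ) atTop (𝓝 0) := by
  have : ∀ n : ℕ, ∃ φ : C(K, ℂ), eLpNorm (f - ⇑φ) 2 μ ≤ ((n : ℝ≥0∞) + 1)⁻¹ := by
    intro n
    obtain ⟨g, hg, -⟩ := hf.exists_boundedContinuous_eLpNorm_sub_le (by simp)
      (ε := ((n : ℝ≥0∞) + 1)⁻¹) (by simp)
    exact ⟨g.toContinuousMap, hg⟩
  choose φ hφ using this
  refine ⟨φ, tendsto_of_tendsto_of_tendsto_of_le_of_le tendsto_const_nhds ?_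
    (fun _ => zero_le) hφ⟩
  have := (tendsto_add_atTop_iff_nat 1).2 ENNReal.tendsto_inv_nat_nhds_zero
  simpa using this

variable [CompactSpace K]

/-- The functional `f ↦ ⟨x, ρ f x⟩` is positive because `f = s* s` with `s = √f`. Its Riesz measure,
tested on `|φ|² = φ* φ`, returns `‖ρ φ x‖²`. -/
theorem exists_spectralMeasure (ρ : C(K, ℂ) →⋆ₐ[ℂ] (H →L[ℂ] H)) (x : H) :
    ∃ μ : Measure K, IsFiniteMeasure μ ∧ ∀ φ : C(K, ℂ), ‖ρ φ x‖ₑ = eLpNorm φ 2 μ := by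
  have hpos : ∀ f : C_c(K, ℝ≥0), 0 ≤ (inner ℂ x (ρ (nnrealToComplex f) x)).re := by
    intro f
    let s : C(K, ℂ) := ⟨fun k => ((NNReal.sqrt (f k) : ℝ) : ℂ), by fun_prop⟩
    have : nnrealToComplex f = star s * s := by
      ext k
      simp only [nnrealToComplex, s, ContinuousMap.coe_mk, ContinuousMap.mul_apply,
        ContinuousMap.star_apply, RCLike.star_def, Complex.conj_ofReal]
      norm_cast
      simp
    rw [this, re_inner_starMul]
    positivity
  let Λ : C_c(K, ℝ≥0) →ₗ[ℝ≥0] ℝ≥0 :=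
    { toFun := fun f => ⟨_, hpos f⟩
      map_add' := by
        intro f g
        have : nnrealToComplex (f + g) = nnrealToComplex f + nnrealToComplex g := by
          ext k; simp [nnrealToComplex]
        apply NNReal.eq
        change (inner ℂ x (ρ _ x)).re = (inner ℂ x (ρ _ x)).re + (inner ℂ x (ρ _ x)).re
        simp [this]
      map_smul' := by
        intro c f
        have : nnrealToComplex (c • f) = ((c : ℝ) : ℂ) • nnrealToComplex f := by
          ext k; simp [nnrealToComplex]
        apply NNReal.eq
        change (inner ℂ x (ρ _ x)).re = (c : ℝ) * (inner ℂ x (ρ _ x)).re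
        rw [this, map_smul, smul_apply, inner_smul_right, Complex.re_ofReal_mul] }
  refine ⟨NNRealRMK.rieszMeasure Λ, ⟨isCompact_univ.measure_lt_top⟩, fun φ => ?_⟩
  apply ennreal_eq_of_sq_eq
  let f : C_c(K, ℝ≥0) := ⟨⟨fun k => ‖φ k‖₊ ^ 2, by fun_prop⟩, HasCompactSupport.of_compactSpace _⟩
  have hf : nnrealToComplex f = star φ * φ := by
    ext k
    simp [nnrealToComplex, f, ← Complex.normSq_eq_conj_mul_self, Complex.normSq_eq_norm_sq]
  have h1 := NNRealRMK.lintegral_rieszMeasure Λ f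
  have h2 : Λ f = ‖ρ φ x‖₊ ^ 2 := by
    ext
    change (inner ℂ x (ρ (nnrealToComplex f) x)).re = _
    rw [hf, re_inner_starMul]
    simp
  rw [eLpNorm_two_sq, enorm_eq_nnnorm, ← ENNReal.coe_pow, ← h2, ← h1]
  simp [f, enorm_eq_nnnorm]

/-- The spectral measure of a vector for a representation of `C(K)`. -/
noncomputable def spectralMeasure (ρ : C(K, ℂ) →⋆ₐ[ℂ] (H →L[ℂ] H)) (x : H) :
    Measure K :=
  (exists_spectralMeasure ρ x).choose

instance (ρ : C(K, ℂ) →⋆ₐ[ℂ] (H →L[ℂ] H)) (x : H) :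
    IsFiniteMeasure (spectralMeasure ρ x) :=
  (exists_spectralMeasure ρ x).choose_spec.1

theorem enorm_apply_eq_eLpNorm (ρ : C(K, ℂ) →⋆ₐ[ℂ] (H →L[ℂ] H)) (x : H)
    (φ : C(K, ℂ)) : ‖ρ φ x‖ₑ = eLpNorm φ 2 (spectralMeasure ρ x) :=
  (exists_spectralMeasure ρ x).choose_spec.2 φ

theorem lintegral_spectralMeasure (ρ : C(K, ℂ) →⋆ₐ[ℂ] (H →L[ℂ] H)) (x : H)
    (φ : C(K, ℂ)) : ∫⁻ k, ‖φ k‖ₑ ^ 2 ∂(spectralMeasure ρ x) = ‖ρ φ x‖ₑ ^ 2 := by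
  rw [enorm_apply_eq_eLpNorm, eLpNorm_two_sq]

/-- This is the parallelogram law for the vectors `ρ φ x` and `ρ φ y`. It serves as the bound
`μ_{x+y} ≤ 2 (μ_x + μ_y)`, which makes domains closed under addition. -/
theorem spectralMeasure_add_add_sub
    (ρ : C(K, ℂ) →⋆ₐ[ℂ] (H →L[ℂ] H)) (x y : H) :
    spectralMeasure ρ (x + y) + spectralMeasure ρ (x - y) =
      (spectralMeasure ρ x + spectralMeasure ρ y) +
        (spectralMeasure ρ x + spectralMeasure ρ y) := by
  apply measure_ext_of_lintegral_sq
  intro φ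
  simp only [lintegral_add_measure, lintegral_spectralMeasure, map_add, map_sub]
  have h := parallelogram_law_with_norm ℂ (ρ φ x) (ρ φ y)
  simp only [enorm_eq_nnnorm]
  norm_cast
  apply NNReal.eq
  push_cast
  linarith

theorem spectralMeasure_smul_eq
    (ρ : C(K, ℂ) →⋆ₐ[ℂ] (H →L[ℂ] H)) (c : ℂ) (x : H) :
    spectralMeasure ρ (c • x) = ‖c‖ₑ ^ 2 • spectralMeasure ρ x := by
  apply measure_ext_of_lintegral_sq
  intro φ
  simp only [lintegral_smul_measure, lintegral_spectralMeasure, map_smul, enorm_smul, mul_pow,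
    smul_eq_mul]

theorem spectralMeasure_univ (ρ : C(K, ℂ) →⋆ₐ[ℂ] (H →L[ℂ] H)) (x : H) :
    spectralMeasure ρ x Set.univ = ‖x‖ₑ ^ 2 := by
  simpa using lintegral_spectralMeasure ρ x 1

end SpectralMeasure

/-! ### Extending a representation from continuous to Borel functions. -/

section Extension

theorem tendsto_of_enorm_sub {E : Type*} [NormedAddCommGroup E] {u : ℕ → E} {y : E}
    (h : Tendsto (fun n => ‖u n - y‖ₑ) atTop (𝓝 0)) : Tendsto u atTop (𝓝 y) := by
  rw [tendsto_iff_edist_tendsto_0]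
  simpa only [edist_eq_enorm_sub] using h

theorem tendsto_enorm_sub {E : Type*} [NormedAddCommGroup E] {u : ℕ → E} {y : E}
    (h : Tendsto u atTop (𝓝 y)) : Tendsto (fun n => ‖u n - y‖ₑ) atTop (𝓝 0) := by
  simpa using (h.sub_const y).enorm

theorem tendsto_eLpNorm_two {α : Type*} [MeasurableSpace α] {μ : Measure α} {f : α → ℂ}
    {g : ℕ → α → ℂ} (hf : AEStronglyMeasurable f μ) (hg : ∀ n, AEStronglyMeasurable (g n) μ)
    (h : Tendsto (fun n => eLpNorm (f - g n) 2 μ) atTop (𝓝 0)) :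
    Tendsto (fun n => eLpNorm (g n) 2 μ) atTop (𝓝 (eLpNorm f 2 μ)) := by
  have h1 : Tendsto (fun n => eLpNorm f 2 μ - eLpNorm (f - g n) 2 μ) atTop
      (𝓝 (eLpNorm f 2 μ)) := by
    simpa using ENNReal.Tendsto.sub (tendsto_const_nhds (x := eLpNorm f 2 μ)) h
      (Or.inr ENNReal.zero_ne_top)
  have h2 : Tendsto (fun n => eLpNorm f 2 μ + eLpNorm (f - g n) 2 μ) atTop
      (𝓝 (eLpNorm f 2 μ)) := by
    simpa using (tendsto_const_nhds (x := eLpNorm f 2 μ)).add h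
  refine tendsto_of_tendsto_of_tendsto_of_le_of_le h1 h2 (fun n => ?_) (fun n => ?_)
  · rw [tsub_le_iff_left]
    simpa using eLpNorm_add_le (hf.sub (hg n)) (hg n) one_le_two
  · simpa using eLpNorm_sub_le hf (hf.sub (hg n)) one_le_two

theorem MemLp.two_add_measure {α : Type*} [MeasurableSpace α] {μ ν : Measure α} {f : α → ℂ}
    (hf : Measurable f) (hμ : MemLp f 2 μ) (hν : MemLp f 2 ν) : MemLp f 2 (μ + ν) := by
  refine ⟨hf.aestronglyMeasurable, ?_⟩
  have h1 := ENNReal.pow_lt_top (n := 2) hμ.2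
  have h2 := ENNReal.pow_lt_top (n := 2) hν.2
  rw [eLpNorm_two_sq] at h1 h2
  have h3 : eLpNorm f 2 (μ + ν) ^ 2 < ∞ := by
    rw [eLpNorm_two_sq, lintegral_add_measure]
    exact ENNReal.add_lt_top.2 ⟨h1, h2⟩
  simpa using h3

variable {K : Type*} [MetricSpace K] [MeasurableSpace K] [BorelSpace K] [CompactSpace K]
variable {H : Type*} [NormedAddCommGroup H] [InnerProductSpace ℂ H] [CompleteSpace H]

/-- `MapsTo ρ f x y` says that `y` is the value at `x` of the operator attached to the Borel
function `f` by the representation `ρ` of `C(K)`: the map `φ ↦ ρ φ x`, an isometry for the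
`L²` norm of the spectral measure of `x`, extended to `f`. -/
def MapsTo (ρ : C(K, ℂ) →⋆ₐ[ℂ] (H →L[ℂ] H)) (f : K → ℂ) (x y : H) : Prop :=
  ∀ φ : C(K, ℂ), ‖y - ρ φ x‖ₑ = eLpNorm (f - ⇑φ) 2 (spectralMeasure ρ x)

variable {ρ : C(K, ℂ) →⋆ₐ[ℂ] (H →L[ℂ] H)} {f g : K → ℂ} {x y z : H}

theorem mapsTo_continuous (ρ : C(K, ℂ) →⋆ₐ[ℂ] (H →L[ℂ] H)) (ψ : C(K, ℂ)) (x : H) :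
    MapsTo ρ ψ x (ρ ψ x) := by
  intro φ
  rw [← ContinuousMap.coe_sub, ← enorm_apply_eq_eLpNorm, map_sub, sub_apply]

theorem MapsTo.enorm_eq (h : MapsTo ρ f x y) : ‖y‖ₑ = eLpNorm f 2 (spectralMeasure ρ x) := by
  simpa using h 0

theorem MapsTo.memLp (h : MapsTo ρ f x y) (hf : Measurable f) :
    MemLp f 2 (spectralMeasure ρ x) :=
  ⟨hf.aestronglyMeasurable, by rw [← h.enorm_eq]; exact enorm_lt_top⟩

theorem MapsTo.tendsto (h : MapsTo ρ f x y) {φ : ℕ → C(K, ℂ)}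
    (hφ : Tendsto (fun n => eLpNorm (f - ⇑(φ n)) 2 (spectralMeasure ρ x)) atTop (𝓝 0)) :
    Tendsto (fun n => ρ (φ n) x) atTop (𝓝 y) := by
  apply tendsto_of_enorm_sub
  simpa only [← h (φ _), enorm_sub_rev y] using hφ

/-- Both sides of the identity defining `MapsTo` pass to the limit. The algebraic rules below are
deduced from continuous functions through this. -/
theorem mapsTo_of_tendsto {g : ℕ → K → ℂ} {w : ℕ → H} (hf : Measurable f)
    (hg : ∀ n, Measurable (g n))
    (hfg : Tendsto (fun n => eLpNorm (f - g n) 2 (spectralMeasure ρ x)) atTop (𝓝 0))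
    (h : ∀ n, MapsTo ρ (g n) x (w n)) (hw : Tendsto w atTop (𝓝 y)) : MapsTo ρ f x y := by
  intro φ
  have h1 : Tendsto (fun n => ‖w n - ρ φ x‖ₑ) atTop (𝓝 ‖y - ρ φ x‖ₑ) :=
    (hw.sub_const _).enorm
  have h2 : Tendsto (fun n => eLpNorm (g n - ⇑φ) 2 (spectralMeasure ρ x)) atTop
      (𝓝 (eLpNorm (f - ⇑φ) 2 (spectralMeasure ρ x))) := by
    have hφ : Measurable φ := φ.continuous.measurable
    refine tendsto_eLpNorm_two (hf.sub hφ).aestronglyMeasurable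
      (fun n => ((hg n).sub hφ).aestronglyMeasurable) ?_
    simpa only [sub_sub_sub_cancel_right] using hfg
  simp only [h _ φ] at h1
  exact tendsto_nhds_unique h1 h2

theorem exists_mapsTo (ρ : C(K, ℂ) →⋆ₐ[ℂ] (H →L[ℂ] H)) (hf : Measurable f)
    (h : MemLp f 2 (spectralMeasure ρ x)) : ∃ y, MapsTo ρ f x y := by
  obtain ⟨φ, hφ⟩ := exists_tendsto_eLpNorm_sub h
  have hc : CauchySeq fun n => ρ (φ n) x := by
    rw [EMetric.cauchySeq_iff]
    intro ε hε
    have hε2 : 0 < ε / 2 := ENNReal.half_pos hε.ne'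
    obtain ⟨N, hN⟩ := eventually_atTop.1 (hφ.eventually_lt_const hε2)
    refine ⟨N, fun m hm n hn => ?_⟩
    rw [edist_eq_enorm_sub, ← sub_apply, ← map_sub, enorm_apply_eq_eLpNorm]
    have : ⇑(φ m - φ n) = (f - ⇑(φ n)) - (f - ⇑(φ m)) := by
      ext k; simp
    rw [this]
    refine (eLpNorm_sub_le ?_ ?_ one_le_two).trans_lt ?_
    · exact (hf.sub (φ n).continuous.measurable).aestronglyMeasurable
    · exact (hf.sub (φ m).continuous.measurable).aestronglyMeasurable
    · exact (ENNReal.add_lt_add (hN n hn) (hN m hm)).trans_eq (ENNReal.add_halves ε)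
  obtain ⟨y, hy⟩ := cauchySeq_tendsto_of_complete hc
  exact ⟨y, mapsTo_of_tendsto hf (fun n => (φ n).continuous.measurable) hφ
    (fun n => mapsTo_continuous ρ (φ n) x) hy⟩

theorem MapsTo.unique (hf : Measurable f) (h : MapsTo ρ f x y) (h' : MapsTo ρ f x z) : y = z := by
  obtain ⟨φ, hφ⟩ := exists_tendsto_eLpNorm_sub (h.memLp hf)
  exact tendsto_nhds_unique (h.tendsto hφ) (h'.tendsto hφ)

theorem tendsto_eLpNorm_of_le {α : Type*} [MeasurableSpace α] {μ ν : Measure α} (hμ : μ ≤ ν)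
    {u : ℕ → α → ℂ} (h : Tendsto (fun n => eLpNorm (u n) 2 ν) atTop (𝓝 0)) :
    Tendsto (fun n => eLpNorm (u n) 2 μ) atTop (𝓝 0) :=
  tendsto_of_tendsto_of_tendsto_of_le_of_le tendsto_const_nhds h (fun _ => zero_le)
    (fun _ => eLpNorm_mono_measure _ hμ)

theorem MapsTo.exists_common_approx {x' y' : H} (hf : Measurable f) (h : MapsTo ρ f x y)
    (h' : MapsTo ρ f x' y') :
    ∃ φ : ℕ → C(K, ℂ), Tendsto (fun n => ρ (φ n) x) atTop (𝓝 y) ∧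
      Tendsto (fun n => ρ (φ n) x') atTop (𝓝 y') ∧
      Tendsto (fun n => eLpNorm (f - ⇑(φ n)) 2 (spectralMeasure ρ (x + x'))) atTop (𝓝 0) := by
  have hm := MemLp.two_add_measure hf (h.memLp hf) (h'.memLp hf)
  -- The doubled sum is the right side of the parallelogram identity, so it dominates the measures
  -- of `x`, `x'` and `x + x'` at once.
  have hm := MemLp.two_add_measure hf hm hm
  obtain ⟨φ, hφ⟩ := exists_tendsto_eLpNorm_sub hm
  refine ⟨φ, h.tendsto (tendsto_eLpNorm_of_le ?_ hφ), h'.tendsto (tendsto_eLpNorm_of_le ?_ hφ),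
    tendsto_eLpNorm_of_le ?_ hφ⟩
  · exact (Measure.le_add_right le_rfl).trans (Measure.le_add_right le_rfl)
  · exact (Measure.le_add_left le_rfl).trans (Measure.le_add_right le_rfl)
  · rw [← spectralMeasure_add_add_sub]
    exact Measure.le_add_right le_rfl

theorem MapsTo.add_vector {x' y' : H} (hf : Measurable f) (h : MapsTo ρ f x y)
    (h' : MapsTo ρ f x' y') : MapsTo ρ f (x + x') (y + y') := by
  obtain ⟨φ, h1, h2, h3⟩ := h.exists_common_approx hf h'
  refine mapsTo_of_tendsto hf (fun n => (φ n).continuous.measurable) h3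
    (fun n => mapsTo_continuous ρ (φ n) _) ?_
  simpa only [map_add] using h1.add h2

theorem MapsTo.smul_vector (c : ℂ) (h : MapsTo ρ f x y) :
    MapsTo ρ f (c • x) (c • y) := by
  intro φ
  rw [map_smul, ← smul_sub, enorm_smul, h φ, spectralMeasure_smul_eq]
  apply ennreal_eq_of_sq_eq
  rw [mul_pow, eLpNorm_two_sq, eLpNorm_two_sq, lintegral_smul_measure, smul_eq_mul]

theorem MapsTo.exists_approx (hf : Measurable f) (h : MapsTo ρ f x y) :
    ∃ φ : ℕ → C(K, ℂ), Tendsto (fun n => ρ (φ n) x) atTop (𝓝 y) ∧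
      Tendsto (fun n => eLpNorm (f - ⇑(φ n)) 2 (spectralMeasure ρ x)) atTop (𝓝 0) := by
  obtain ⟨φ, hφ⟩ := exists_tendsto_eLpNorm_sub (h.memLp hf)
  exact ⟨φ, h.tendsto hφ, hφ⟩

theorem MapsTo.add_function (hf : Measurable f) (hg : Measurable g) (h : MapsTo ρ f x y)
    (h' : MapsTo ρ g x z) : MapsTo ρ (f + g) x (y + z) := by
  obtain ⟨φ, h1, h2⟩ := h.exists_approx hf
  obtain ⟨ψ, h3, h4⟩ := h'.exists_approx hg
  refine mapsTo_of_tendsto (g := fun n => ⇑(φ n + ψ n)) (hf.add hg)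
    (fun n => (φ n + ψ n).continuous.measurable) ?_ (fun n => mapsTo_continuous ρ _ x) ?_
  · refine tendsto_of_tendsto_of_tendsto_of_le_of_le tendsto_const_nhds
      (by simpa using h2.add h4) (fun _ => zero_le) (fun n => ?_)
    have : f + g - ⇑(φ n + ψ n) = (f - ⇑(φ n)) + (g - ⇑(ψ n)) := by
      ext k; simp; ring
    rw [this]
    exact eLpNorm_add_le (hf.sub (φ n).continuous.measurable).aestronglyMeasurable
      (hg.sub (ψ n).continuous.measurable).aestronglyMeasurable one_le_two
  · simpa only [map_add, add_apply] using h1.add h3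

theorem MapsTo.smul_function (c : ℂ) (hf : Measurable f) (h : MapsTo ρ f x y) :
    MapsTo ρ (c • f) x (c • y) := by
  obtain ⟨φ, h1, h2⟩ := h.exists_approx hf
  refine mapsTo_of_tendsto (g := fun n => ⇑(c • φ n)) (hf.const_smul c)
    (fun n => (c • φ n).continuous.measurable) ?_ (fun n => mapsTo_continuous ρ _ x) ?_
  · have : ∀ n, c • f - ⇑(c • φ n) = c • (f - ⇑(φ n)) := fun n => by
      ext k; simp [mul_sub]
    simp only [this, eLpNorm_const_smul]
    simpa using ENNReal.Tendsto.const_mul h2 (Or.inr enorm_ne_top)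
  · simpa only [map_smul, smul_apply] using h1.const_smul c

/-- The representation property of the extension for a continuous factor. -/
theorem MapsTo.continuous_mul (ψ : C(K, ℂ)) (hf : Measurable f) (h : MapsTo ρ f x y) :
    MapsTo ρ (⇑ψ * f) x (ρ ψ y) := by
  obtain ⟨φ, h1, h2⟩ := h.exists_approx hf
  refine mapsTo_of_tendsto (g := fun n => ⇑(ψ * φ n)) (ψ.continuous.measurable.mul hf)
    (fun n => (ψ * φ n).continuous.measurable) ?_ (fun n => mapsTo_continuous ρ _ x) ?_
  · have hle : ∀ n, eLpNorm (⇑ψ * f - ⇑(ψ * φ n)) 2 (spectralMeasure ρ x) ≤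
        ENNReal.ofReal ‖ψ‖ * eLpNorm (f - ⇑(φ n)) 2 (spectralMeasure ρ x) := fun n => by
      apply eLpNorm_le_mul_eLpNorm_of_ae_le_mul
      filter_upwards with k
      have : (⇑ψ * f - ⇑(ψ * φ n)) k = ψ k * (f k - φ n k) := by simp [mul_sub]
      rw [this, norm_mul]
      exact mul_le_mul_of_nonneg_right (ψ.norm_coe_le_norm k) (norm_nonneg _)
    refine tendsto_of_tendsto_of_tendsto_of_le_of_le tendsto_const_nhds ?_
      (fun _ => zero_le) hle
    simpa using ENNReal.Tendsto.const_mul (a := ENNReal.ofReal ‖ψ‖) h2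
      (Or.inr ENNReal.ofReal_ne_top)
  · simp only [map_mul, mul_apply_eq_comp]
    exact ((ρ ψ).continuous.tendsto y).comp h1

/-- For continuous `ψ`, `‖ρ ψ y‖² = ∫ |ψ f|² dμ_x`, since `ρ ψ y` is the value at `x` of the
operator of `ψ f`. -/
theorem MapsTo.spectralMeasure_eq (hf : Measurable f) (h : MapsTo ρ f x y) :
    spectralMeasure ρ y = (spectralMeasure ρ x).withDensity fun k => ‖f k‖ₑ ^ 2 := by
  apply measure_ext_of_lintegral_sq
  intro ψ
  rw [lintegral_spectralMeasure, (h.continuous_mul ψ hf).enorm_eq, eLpNorm_two_sq,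
    lintegral_withDensity_eq_lintegral_mul _ (hf.enorm.pow_const 2)
      (ψ.continuous.measurable.enorm.pow_const 2)]
  congr 1
  ext k
  simp [mul_pow, mul_comm]

theorem MapsTo.eLpNorm_mul (hg : Measurable g) (h : MapsTo ρ g x y) (hf : Measurable f) :
    eLpNorm (f * g) 2 (spectralMeasure ρ x) = eLpNorm f 2 (spectralMeasure ρ y) := by
  apply ennreal_eq_of_sq_eq
  rw [eLpNorm_two_sq, eLpNorm_two_sq, h.spectralMeasure_eq hg,
    lintegral_withDensity_eq_lintegral_mul _ (hg.enorm.pow_const 2) (hf.enorm.pow_const 2)]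
  congr 1
  ext k
  simp [mul_pow, mul_comm]

/-- By the density formula, `φₙ → f` in `L²(μ_y)` is the same as `φₙ g → f g` in `L²(μ_x)`. -/
theorem MapsTo.mul (hf : Measurable f) (hg : Measurable g) (h : MapsTo ρ g x y)
    (h' : MapsTo ρ f y z) : MapsTo ρ (f * g) x z := by
  obtain ⟨φ, h1, h2⟩ := h'.exists_approx hf
  refine mapsTo_of_tendsto (g := fun n => ⇑(φ n) * g) (hf.mul hg)
    (fun n => (φ n).continuous.measurable.mul hg) ?_ (fun n => h.continuous_mul (φ n) hg) h1
  simpa only [← sub_mul, h.eLpNorm_mul hg (hf.sub (φ _).continuous.measurable)] using h2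

/-- Given `x` in the domain of `g`, `f g ∈ L²(μ_x)` forces `f ∈ L²(μ_y)`. This is the nontrivial
half of the domain axiom for products. -/
theorem MapsTo.of_mul (hf : Measurable f) (hg : Measurable g) (h : MapsTo ρ g x y)
    (h' : MapsTo ρ (f * g) x z) : MapsTo ρ f y z := by
  obtain ⟨w, hw⟩ := exists_mapsTo (x := y) ρ hf
    ⟨hf.aestronglyMeasurable, by
      rw [← h.eLpNorm_mul hg hf]; exact (h'.memLp (hf.mul hg)).2⟩
  rwa [(h.mul hf hg hw).unique (hf.mul hg) h'] at hw

/-- One sequence approximates `f` for both `μ_x` and `μ_{x'}`, and for continuous functions the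
relation is `ρ (star φ) = (ρ φ)*`. -/
theorem MapsTo.inner_eq {x' y' : H} (hf : Measurable f) (h : MapsTo ρ f x y)
    (h' : MapsTo ρ (star f) x' y') : inner ℂ y x' = inner ℂ x y' := by
  have hf' : Measurable (star f) := Complex.continuous_conj.measurable.comp hf
  have hstar : ∀ (u : K → ℂ) (μ : Measure K), eLpNorm (star u) 2 μ = eLpNorm u 2 μ :=
    fun u μ => eLpNorm_congr_norm_ae (by filter_upwards with k; simp)
  have hm' : MemLp f 2 (spectralMeasure ρ x') :=
    ⟨hf.aestronglyMeasurable, by rw [← hstar]; exact (h'.memLp hf').2⟩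
  obtain ⟨φ, hφ⟩ := exists_tendsto_eLpNorm_sub (MemLp.two_add_measure hf (h.memLp hf) hm')
  have h1 : Tendsto (fun n => ρ (φ n) x) atTop (𝓝 y) :=
    h.tendsto (tendsto_eLpNorm_of_le (Measure.le_add_right le_rfl) hφ)
  have h2 : Tendsto (fun n => ρ (star (φ n)) x') atTop (𝓝 y') := by
    apply h'.tendsto
    have : ∀ n, star f - ⇑(star (φ n)) = star (f - ⇑(φ n)) := fun n => by
      ext k; simp
    simp only [this, hstar]
    exact tendsto_eLpNorm_of_le (Measure.le_add_left le_rfl) hφ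
  refine tendsto_nhds_unique (h1.inner tendsto_const_nhds) ?_
  simpa only [map_star, ContinuousLinearMap.star_eq_adjoint,
    ContinuousLinearMap.adjoint_inner_right] using
      (tendsto_const_nhds (x := x)).inner (𝕜 := ℂ) h2

end Extension

/-! ### Truncation of unbounded functions. -/

section Cutoff

variable {X : Type*}

/-- The indicator function of the set where `f` is bounded by `n`. -/
noncomputable def cutoff (f : X → ℂ) (n : ℕ) : X → ℂ := {a | ‖f a‖ ≤ n}.indicator 1

theorem measurable_cutoff [MeasurableSpace X] {f : X → ℂ} (hf : Measurable f) (n : ℕ) :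
    Measurable (cutoff f n) :=
  measurable_one.indicator (measurableSet_le hf.norm measurable_const)

theorem norm_cutoff_le (f : X → ℂ) (n : ℕ) (a : X) : ‖cutoff f n a‖ ≤ 1 := by
  by_cases h : ‖f a‖ ≤ n <;> simp [cutoff, h]

theorem norm_cutoff_mul_le (f : X → ℂ) (n : ℕ) (a : X) : ‖(cutoff f n * f) a‖ ≤ n := by
  by_cases h : ‖f a‖ ≤ n <;> simp [cutoff, h]

theorem tendsto_cutoff (f : X → ℂ) (a : X) : Tendsto (fun n => cutoff f n a) atTop (𝓝 1) := by
  obtain ⟨N, hN⟩ := exists_nat_ge ‖f a‖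
  refine tendsto_const_nhds.congr' ?_
  filter_upwards [eventually_ge_atTop N] with n hn
  have : ‖f a‖ ≤ n := hN.trans (by exact_mod_cast hn)
  simp [cutoff, this]

theorem cutoff_mul_self (f : X → ℂ) (n : ℕ) : cutoff f n * cutoff f n = cutoff f n := by
  ext a
  by_cases h : ‖f a‖ ≤ n <;> simp [cutoff, h]

theorem star_cutoff (f : X → ℂ) (n : ℕ) : star (cutoff f n) = cutoff f n := by
  ext a
  by_cases h : ‖f a‖ ≤ n <;> simp [cutoff, h]

end Cutoff

theorem tendsto_eLpNorm_zero_of_dominated {α : Type*} [MeasurableSpace α] {μ : Measure α}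
    {u : ℕ → α → ℂ} {b : α → ℂ} (hu : ∀ n, Measurable (u n)) (hb : MemLp b 2 μ)
    (hub : ∀ n a, ‖u n a‖ ≤ ‖b a‖) (hlim : ∀ a, Tendsto (fun n => u n a) atTop (𝓝 0)) :
    Tendsto (fun n => eLpNorm (u n) 2 μ) atTop (𝓝 0) := by
  have h : Tendsto (fun n => ∫⁻ a, ‖u n a‖ₑ ^ 2 ∂μ) atTop (𝓝 (∫⁻ _, 0 ∂μ)) := by
    refine tendsto_lintegral_of_dominated_convergence (fun a => ‖b a‖ₑ ^ 2)
      (fun n => (hu n).enorm.pow_const 2) (fun n => ?_) ?_ ?_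
    · filter_upwards with a
      exact pow_le_pow_left₀ zero_le (enorm_le_iff_norm_le.2 (hub n a)) 2
    · rw [← eLpNorm_two_sq]
      exact (ENNReal.pow_lt_top hb.2).ne
    · filter_upwards with a
      have := ENNReal.Tendsto.pow (n := 2) (hlim a).enorm
      simpa using this
  simp only [← eLpNorm_two_sq, lintegral_zero] at h
  have h2 := (ENNReal.continuous_rpow_const (y := 1 / 2)).tendsto 0 |>.comp h
  have h3 : ∀ a : ℝ≥0∞, (a ^ 2) ^ (1 / 2 : ℝ) = a := fun a => by
    rw [← ENNReal.rpow_natCast, ← ENNReal.rpow_mul]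
    norm_num
  simp only [Function.comp_def, h3] at h2
  simpa using h2

/-! ### Closedness of the operators attached to Borel functions. -/

section Closed

variable {K : Type*} [MetricSpace K] [MeasurableSpace K] [BorelSpace K] [CompactSpace K]
variable {H : Type*} [NormedAddCommGroup H] [InnerProductSpace ℂ H] [CompleteSpace H]
variable {ρ : C(K, ℂ) →⋆ₐ[ℂ] (H →L[ℂ] H)} {f g : K → ℂ} {x y z : H} {C : ℝ}

theorem exists_mapsTo_of_bounded (ρ : C(K, ℂ) →⋆ₐ[ℂ] (H →L[ℂ] H)) (hf : Measurable f)
    (hC : ∀ k, ‖f k‖ ≤ C) (x : H) : ∃ y, MapsTo ρ f x y :=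
  exists_mapsTo ρ hf (MemLp.of_bound hf.aestronglyMeasurable C (ae_of_all _ hC))

theorem MapsTo.enorm_le_of_bounded (hC : ∀ k, ‖f k‖ ≤ C) (h : MapsTo ρ f x y) :
    ‖y‖ₑ ≤ ENNReal.ofReal C * ‖x‖ₑ := by
  have h1 : eLpNorm (1 : K → ℂ) 2 (spectralMeasure ρ x) = ‖x‖ₑ := by
    simpa using (enorm_apply_eq_eLpNorm ρ x 1).symm
  rw [h.enorm_eq, ← h1]
  refine eLpNorm_le_mul_eLpNorm_of_ae_le_mul (ae_of_all _ fun k => ?_) 2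
  simpa using hC k

theorem mapsTo_of_tendsto_of_bounded (hf : Measurable f) (hC : ∀ k, ‖f k‖ ≤ C) {u w : ℕ → H}
    (h : ∀ n, MapsTo ρ f (u n) (w n)) (hu : Tendsto u atTop (𝓝 x))
    (hw : Tendsto w atTop (𝓝 y)) : MapsTo ρ f x y := by
  obtain ⟨y', hy'⟩ := exists_mapsTo_of_bounded ρ hf hC x
  have hle : ∀ n, ‖w n - y'‖ₑ ≤ ENNReal.ofReal C * ‖u n - x‖ₑ := fun n => by
    have := (h n).add_vector hf (hy'.smul_vector (-1))
    simpa [← sub_eq_add_neg] using this.enorm_le_of_bounded hC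
  have hw' : Tendsto w atTop (𝓝 y') := by
    apply tendsto_of_enorm_sub
    refine tendsto_of_tendsto_of_tendsto_of_le_of_le tendsto_const_nhds ?_ (fun _ => zero_le) hle
    simpa using ENNReal.Tendsto.const_mul (a := ENNReal.ofReal C) (tendsto_enorm_sub hu)
      (Or.inr ENNReal.ofReal_ne_top)
  rwa [tendsto_nhds_unique hw hw']

theorem MapsTo.tendsto_of_bounded {u : ℕ → K → ℂ} {w : ℕ → H} (hu : ∀ n, Measurable (u n))
    (hf : Measurable f) (hC : ∀ n k, ‖u n k‖ ≤ C)
    (hlim : ∀ k, Tendsto (fun n => u n k) atTop (𝓝 (f k)))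
    (h : ∀ n, MapsTo ρ (u n) x (w n)) (h' : MapsTo ρ f x y) : Tendsto w atTop (𝓝 y) := by
  have hfC : ∀ k, ‖f k‖ ≤ C := fun k =>
    le_of_tendsto (hlim k).norm (Eventually.of_forall fun n => hC n k)
  have h1 : Tendsto (fun n => eLpNorm (u n - f) 2 (spectralMeasure ρ x)) atTop (𝓝 0) := by
    refine tendsto_eLpNorm_zero_of_dominated (b := fun _ => ((2 * C : ℝ) : ℂ))
      (fun n => (hu n).sub hf) (memLp_const _) (fun n k => ?_) (fun k => ?_)
    · rw [Complex.norm_real, Real.norm_eq_abs]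
      refine le_trans ?_ (le_abs_self _)
      exact (norm_sub_le (u n k) (f k)).trans (by linarith [hC n k, hfC k])
    · simpa using (hlim k).sub_const (f k)
  apply tendsto_of_enorm_sub
  have h2 : ∀ n, ‖w n - y‖ₑ = eLpNorm (u n - f) 2 (spectralMeasure ρ x) := fun n => by
    have := (h n).add_function (hu n) (hf.const_smul (-1 : ℂ)) (h'.smul_function (-1) hf)
    simpa [← sub_eq_add_neg] using this.enorm_eq
  simpa only [h2] using h1

/-- Each truncation of `f` acts boundedly, so it maps `x` to `E m y`, a vector of norm at most
`‖y‖`. Fatou then puts `f` in `L²(μ_x)`, and letting `m → ∞` recovers `f` and `y`. -/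
theorem mapsTo_of_tendsto_closed (hf : Measurable f) {u w : ℕ → H}
    (h : ∀ n, MapsTo ρ f (u n) (w n)) (hu : Tendsto u atTop (𝓝 x))
    (hw : Tendsto w atTop (𝓝 y)) : MapsTo ρ f x y := by
  have hcm := measurable_cutoff hf
  choose E hE using fun (m : ℕ) (v : H) =>
    exists_mapsTo_of_bounded ρ (hcm m) (norm_cutoff_le f m) v
  have hE_lim : ∀ m, Tendsto (fun n => E m (w n)) atTop (𝓝 (E m y)) := by
    intro m
    apply tendsto_of_enorm_sub
    refine tendsto_of_tendsto_of_tendsto_of_le_of_le tendsto_const_nhds (tendsto_enorm_sub hw)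
      (fun _ => zero_le) (fun n => ?_)
    have := (hE m (w n)).add_vector (hcm m) ((hE m y).smul_vector (-1))
    simpa [← sub_eq_add_neg] using this.enorm_le_of_bounded (norm_cutoff_le f m)
  have hcut : ∀ m, MapsTo ρ (cutoff f m * f) x (E m y) := fun m =>
    mapsTo_of_tendsto_of_bounded ((hcm m).mul hf) (norm_cutoff_mul_le f m)
      (fun n => (h n).mul (hcm m) hf (hE m (w n))) hu (hE_lim m)
  have hmem : MemLp f 2 (spectralMeasure ρ x) := by
    refine ⟨hf.aestronglyMeasurable, lt_of_le_of_lt ?_ (enorm_lt_top (x := y))⟩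
    refine Lp.eLpNorm_le_of_ae_tendsto (u := atTop) (f := fun m => cutoff f m * f) ?_ ?_ ?_
    · refine Eventually.of_forall fun m => ?_
      rw [← (hcut m).enorm_eq]
      simpa using (hE m y).enorm_le_of_bounded (norm_cutoff_le f m)
    · exact fun m => ((hcm m).mul hf).aestronglyMeasurable
    · filter_upwards with k
      simpa using (tendsto_cutoff f k).mul_const (f k)
  refine mapsTo_of_tendsto hf (fun m => (hcm m).mul hf) ?_ hcut ?_
  · refine tendsto_eLpNorm_zero_of_dominated (fun m => hf.sub ((hcm m).mul hf)) hmem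
      (fun m k => ?_) (fun k => ?_)
    · by_cases hk : ‖f k‖ ≤ m <;> simp [cutoff, hk]
    · simpa using ((tendsto_cutoff f k).mul_const (f k)).const_sub (f k)
  · have h1 : MapsTo ρ 1 y y := by simpa using mapsTo_continuous ρ 1 y
    exact MapsTo.tendsto_of_bounded hcm measurable_one (norm_cutoff_le f) (tendsto_cutoff f)
      (fun m => hE m y) h1

/-- The graph of the operator attached to a Borel function by a representation of `C(K)`. -/
def mapsToGraph (ρ : C(K, ℂ) →⋆ₐ[ℂ] (H →L[ℂ] H)) (hf : Measurable f) : Submodule ℂ (H × H) where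
  carrier := {p | MapsTo ρ f p.1 p.2}
  add_mem' h h' := h.add_vector hf h'
  zero_mem' := by
    have h0 : spectralMeasure ρ 0 = 0 := by
      rw [← Measure.measure_univ_eq_zero, spectralMeasure_univ]
      simp
    intro φ
    simp [h0]
  smul_mem' c _ h := h.smul_vector c

theorem mapsToGraph_single_valued (hf : Measurable f) :
    ∀ p ∈ mapsToGraph ρ hf, p.1 = 0 → p.2 = 0 := by
  rintro ⟨x, y⟩ h (rfl : x = 0)
  exact MapsTo.unique hf h (mapsToGraph ρ hf).zero_mem

/-- The closed operator attached to a Borel function by a representation of `C(K)`. -/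
noncomputable def spectralOp (ρ : C(K, ℂ) →⋆ₐ[ℂ] (H →L[ℂ] H)) (hf : Measurable f) : ClosedOp H :=
  ⟨(mapsToGraph ρ hf).toLinearPMap, by
    rw [LinearPMap.IsClosed, Submodule.toLinearPMap_graph_eq _ (mapsToGraph_single_valued hf)]
    refine IsSeqClosed.isClosed fun p q hp hq => ?_
    exact mapsTo_of_tendsto_closed hf hp ((continuous_fst.tendsto _).comp hq)
      ((continuous_snd.tendsto _).comp hq)⟩

theorem mem_graph_spectralOp (hf : Measurable f) :
    (x, y) ∈ (spectralOp ρ hf).1.graph ↔ MapsTo ρ f x y := by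
  rw [spectralOp, Submodule.toLinearPMap_graph_eq _ (mapsToGraph_single_valued hf)]
  rfl

end Closed

/-! ### Sums, multiples and products of operators in terms of graphs. -/

section Graphs

variable {H : Type*} [NormedAddCommGroup H] [InnerProductSpace ℂ H]

theorem mem_graph_add {A B : H →ₗ.[ℂ] H} {x y : H} :
    (x, y) ∈ (A + B).graph ↔ ∃ a b, (x, a) ∈ A.graph ∧ (x, b) ∈ B.graph ∧ a + b = y := by
  rw [LinearPMap.mem_graph_iff']
  constructor
  · rintro ⟨⟨u, hu⟩, h⟩
    obtain ⟨rfl, rfl⟩ := Prod.mk.inj h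
    exact ⟨A ⟨u, hu.1⟩, B ⟨u, hu.2⟩, A.mem_graph ⟨u, hu.1⟩, B.mem_graph ⟨u, hu.2⟩, rfl⟩
  · rintro ⟨a, b, ha, hb, rfl⟩
    rw [LinearPMap.mem_graph_iff'] at ha hb
    obtain ⟨⟨u, hu⟩, h⟩ := ha
    obtain ⟨⟨v, hv⟩, h'⟩ := hb
    obtain ⟨rfl, rfl⟩ := Prod.mk.inj h
    obtain ⟨rfl, rfl⟩ := Prod.mk.inj h'
    exact ⟨⟨v, hu, hv⟩, rfl⟩

theorem mem_graph_smul {A : H →ₗ.[ℂ] H} {c : ℂ} {x y : H} :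
    (x, y) ∈ (c • A).graph ↔ ∃ a, (x, a) ∈ A.graph ∧ c • a = y := by
  rw [LinearPMap.mem_graph_iff']
  constructor
  · rintro ⟨⟨u, hu⟩, h⟩
    obtain ⟨rfl, rfl⟩ := Prod.mk.inj h
    exact ⟨A ⟨u, hu⟩, A.mem_graph _, rfl⟩
  · rintro ⟨a, ha, rfl⟩
    rw [LinearPMap.mem_graph_iff'] at ha
    obtain ⟨⟨u, hu⟩, h⟩ := ha
    obtain ⟨rfl, rfl⟩ := Prod.mk.inj h
    exact ⟨⟨u, hu⟩, rfl⟩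

theorem mem_graph_opMul {A B : H →ₗ.[ℂ] H} {x y : H} :
    (x, y) ∈ (opMul A B).graph ↔ ∃ z, (x, z) ∈ B.graph ∧ (z, y) ∈ A.graph := by
  constructor
  · rw [LinearPMap.mem_graph_iff']
    rintro ⟨⟨u, hu⟩, h⟩
    obtain ⟨rfl, rfl⟩ := Prod.mk.inj h
    obtain ⟨hB, hA⟩ := (mem_opMul_domain A B u).1 hu
    exact ⟨B ⟨u, hB⟩, B.mem_graph ⟨u, hB⟩, A.mem_graph ⟨B ⟨u, hB⟩, hA⟩⟩
  · rintro ⟨z, hz, hy⟩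
    rw [LinearPMap.mem_graph_iff'] at hz hy
    obtain ⟨⟨u, hu⟩, h⟩ := hz
    obtain ⟨⟨v, hv⟩, h'⟩ := hy
    obtain ⟨rfl, rfl⟩ := Prod.mk.inj h
    obtain ⟨rfl, rfl⟩ := Prod.mk.inj h'
    rw [← opMul_apply A B u hu hv]
    exact (opMul A B).mem_graph ⟨u, (mem_opMul_domain A B u).2 ⟨hu, hv⟩⟩

theorem mem_graph_ofBounded {T : H →L[ℂ] H} {x y : H} :
    (x, y) ∈ (ofBounded T).1.graph ↔ T x = y := by
  simp [ofBounded]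

theorem ClosedOp.ext_graph {A B : ClosedOp H}
    (h : ∀ x y, (x, y) ∈ A.1.graph ↔ (x, y) ∈ B.1.graph) : A = B :=
  Subtype.ext (LinearPMap.eq_of_eq_graph (Submodule.ext fun p => h p.1 p.2))

theorem ofBounded_injective : Function.Injective (ofBounded : (H →L[ℂ] H) → ClosedOp H) := by
  intro S T h
  ext x
  have : (x, S x) ∈ (ofBounded T).1.graph := by rw [← h, mem_graph_ofBounded]
  rw [mem_graph_ofBounded] at this
  exact this.symm

/-- The closed graph theorem. -/
theorem ClosedOp.exists_eq_ofBounded [CompleteSpace H] {A : ClosedOp H}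
    (h : ∀ x, ∃ y, (x, y) ∈ A.1.graph) : ∃ T : H →L[ℂ] H, A = ofBounded T := by
  choose t ht using h
  let T : H →ₗ[ℂ] H :=
    { toFun := t
      map_add' := fun x y => A.1.mem_graph_snd_inj (ht _) (A.1.graph.add_mem (ht x) (ht y)) rfl
      map_smul' := fun c x => A.1.mem_graph_snd_inj (ht _) (A.1.graph.smul_mem c (ht x)) rfl }
  have hT : ∀ x y, (x, y) ∈ A.1.graph ↔ T x = y := fun x y =>
    ⟨fun hy => A.1.mem_graph_snd_inj (ht x) hy rfl, fun hy => hy ▸ ht x⟩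
  have hg : T.graph = A.1.graph := by
    ext ⟨x, y⟩
    rw [hT, LinearMap.mem_graph_iff, eq_comm]
  refine ⟨ContinuousLinearMap.ofIsClosedGraph (g := T) (by rw [hg]; exact A.2),
    ClosedOp.ext_graph fun x y => ?_⟩
  rw [mem_graph_ofBounded, hT]
  rfl

end Graphs

/-! ### Existence of the calculus. -/

section Existence

theorem measurable_comp_measFun {X K : Type*} [MeasurableSpace X] [MeasurableSpace K]
    {e : K → X} (he : Measurable e) (f : MeasFun X) :
    Measurable (f.1 ∘ e) :=
  Measurable.comp f.2 he

variable {K : Type*} [MetricSpace K] [MeasurableSpace K] [BorelSpace K] [CompactSpace K]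
variable {H : Type*} [NormedAddCommGroup H] [InnerProductSpace ℂ H] [CompleteSpace H]
variable {X : Type*} [MeasurableSpace X]

/-- The calculus on `K` is pulled back along `e`, which lets it live on all of `ℂ^d` while being
concentrated on the compact set. -/
theorem isMeasurableCalculus_of_graph {Φ : MeasFun X → ClosedOp H}
    (ρ : C(K, ℂ) →⋆ₐ[ℂ] (H →L[ℂ] H)) {e : K → X} (he : Measurable e)
    (hΦ : ∀ f x y, (x, y) ∈ (Φ f).1.graph ↔ MapsTo ρ (f.1 ∘ e) x y) :
    IsMeasurableCalculus Φ where
  map_one := by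
    refine ClosedOp.ext_graph fun x y => ?_
    rw [hΦ, mem_graph_ofBounded]
    have h1 : MapsTo ρ ((1 : X → ℂ) ∘ e) x x := by
      simpa using mapsTo_continuous ρ 1 x
    exact ⟨fun h => h1.unique measurable_one h, fun h => h ▸ h1⟩
  add_le f g := by
    refine LinearPMap.le_of_le_graph ?_
    rintro ⟨x, y⟩ h
    obtain ⟨a, b, ha, hb, rfl⟩ := mem_graph_add.1 h
    rw [hΦ] at ha hb ⊢
    exact ha.add_function (measurable_comp_measFun he f) (measurable_comp_measFun he g) hb
  smul_le c f := by
    refine LinearPMap.le_of_le_graph ?_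
    rintro ⟨x, y⟩ h
    obtain ⟨a, ha, rfl⟩ := mem_graph_smul.1 h
    rw [hΦ] at ha ⊢
    exact ha.smul_function c (measurable_comp_measFun he f)
  mul_le f g := by
    refine LinearPMap.le_of_le_graph ?_
    rintro ⟨x, y⟩ h
    obtain ⟨z, hz, hy⟩ := mem_graph_opMul.1 h
    rw [hΦ] at hz hy ⊢
    exact hz.mul (measurable_comp_measFun he f) (measurable_comp_measFun he g) hy
  mul_domain f g := by
    have hf := measurable_comp_measFun he f
    have hg := measurable_comp_measFun he g
    ext x
    simp only [Submodule.mem_inf, LinearPMap.mem_domain_iff, mem_graph_opMul, hΦ]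
    constructor
    · rintro ⟨y, z, hz, hy⟩
      exact ⟨⟨z, hz⟩, y, hz.mul hf hg hy⟩
    · rintro ⟨⟨z, hz⟩, y, hy⟩
      exact ⟨y, z, hz, hz.of_mul hf hg hy⟩
  bounded f := by
    rintro ⟨C, hC⟩
    have hf := measurable_comp_measFun he f
    have hC' : ∀ a, ‖(star f).1 a‖ ≤ C := fun a => by
      have : (star f).1 a = star (f.1 a) := rfl
      rw [this, norm_star]
      exact hC a
    obtain ⟨T, hT⟩ := ClosedOp.exists_eq_ofBounded (A := Φ f) fun x => by
      simpa only [hΦ] using exists_mapsTo_of_bounded ρ hf (fun k => hC (e k)) x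
    obtain ⟨S, hS⟩ := ClosedOp.exists_eq_ofBounded (A := Φ (star f)) fun x => by
      simpa only [hΦ] using exists_mapsTo_of_bounded ρ (measurable_comp_measFun he (star f))
        (fun k => hC' (e k)) x
    refine ⟨T, hT, ?_⟩
    rw [hS]
    congr 1
    rw [ContinuousLinearMap.eq_adjoint_iff]
    intro x y
    have h1 : MapsTo ρ (f.1 ∘ e) y (T y) := by rw [← hΦ, hT, mem_graph_ofBounded]
    have h2 : MapsTo ρ ((star f).1 ∘ e) x (S x) := by rw [← hΦ, hS, mem_graph_ofBounded]
    rw [← inner_conj_symm, ← h1.inner_eq hf h2, inner_conj_symm]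
  weak_bp f g := by
    rintro ⟨C, hC⟩ hlim T S hT hS x y
    -- The convergence is even strong, by dominated convergence in `L²(μ_x)`.
    refine Tendsto.inner ?_ tendsto_const_nhds
    refine MapsTo.tendsto_of_bounded (ρ := ρ) (x := x) (C := C)
      (fun n => measurable_comp_measFun he (f n)) (measurable_comp_measFun he g)
      (fun n k => hC n (e k)) (fun k => hlim (e k)) (fun n => ?_) ?_
    · rw [← hΦ, hT, mem_graph_ofBounded]
    · rw [← hΦ, hS, mem_graph_ofBounded]

theorem exists_isMeasurableCalculus (ρ : C(K, ℂ) →⋆ₐ[ℂ] (H →L[ℂ] H)) {e : K → X}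
    (he : Measurable e) :
    ∃ Φ : MeasFun X → ClosedOp H, IsMeasurableCalculus Φ ∧
      ∀ (f : MeasFun X) (φ : C(K, ℂ)), f.1 ∘ e = φ → Φ f = ofBounded (ρ φ) := by
  refine ⟨fun f => spectralOp ρ (measurable_comp_measFun he f),
    isMeasurableCalculus_of_graph ρ he fun f x y => mem_graph_spectralOp _, fun f φ h => ?_⟩
  refine ClosedOp.ext_graph fun x y => ?_
  have h1 := mapsTo_continuous ρ φ x
  rw [mem_graph_spectralOp, mem_graph_ofBounded, h]
  exact ⟨fun h2 => h1.unique φ.continuous.measurable h2, fun h2 => h2 ▸ h1⟩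

open WeakDual in
theorem exists_representation {d : ℕ} (A : Fin d → H →L[ℂ] H) (hnormal : ∀ j, IsStarNormal (A j))
    (hcomm : ∀ i j, A i * A j = A j * A i) :
    ∃ (K : Set (Fin d → ℂ)) (_ : IsCompact K) (ρ : C(K, ℂ) →⋆ₐ[ℂ] (H →L[ℂ] H)),
      ∀ (j : Fin d) (φ : C(K, ℂ)), (∀ k : K, φ k = k.1 j) → ρ φ = A j := by
  have hc : IsMulCommutative (StarAlgebra.adjoin ℂ (Set.range A)) := by
    refine StarAlgebra.isMulCommutative_adjoin ℂ ?_ ?_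
    · rintro _ ⟨i, rfl⟩ _ ⟨j, rfl⟩
      exact hcomm i j
    · rintro _ ⟨i, rfl⟩ _ ⟨j, rfl⟩
      -- Fuglede's theorem: what commutes with a normal operator commutes with its adjoint.
      exact (hnormal j).commute_star_right (hcomm i j)
  let S := (StarAlgebra.adjoin ℂ (Set.range A)).topologicalClosure
  have : IsClosed (S : Set (H →L[ℂ] H)) := StarSubalgebra.isClosed_topologicalClosure _
  let _ : CStarAlgebra S := inferInstance
  let _ : CommCStarAlgebra S :=
    { (inferInstance : CStarAlgebra S) with
      mul_comm := (StarSubalgebra.commRingTopologicalClosure _ fun x y =>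
        mul_comm' x y).mul_comm }
  have hA : ∀ j, A j ∈ S := fun j =>
    StarSubalgebra.le_topologicalClosure _ (StarAlgebra.subset_adjoin ℂ _ ⟨j, rfl⟩)
  let G := gelfandStarTransform S
  -- The character space need not be metrizable, whereas its image in `ℂ^d` is a compact metric
  -- space, as the measure theory above requires.
  let e : C(characterSpace ℂ S, Fin d → ℂ) :=
    ⟨fun χ j => G ⟨A j, hA j⟩ χ, by fun_prop⟩
  let e' : C(characterSpace ℂ S, Set.range e) := ⟨fun χ => ⟨e χ, χ, rfl⟩, by fun_prop⟩
  let ρ : C(Set.range e, ℂ) →⋆ₐ[ℂ] (H →L[ℂ] H) :=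
    S.subtype.comp ((G.symm : C(characterSpace ℂ S, ℂ) →⋆ₐ[ℂ] S).comp
      (ContinuousMap.compStarAlgHom' ℂ ℂ e'))
  refine ⟨Set.range e, isCompact_range e.continuous, ρ, fun j φ hφ => ?_⟩
  have : φ.comp e' = G ⟨A j, hA j⟩ := by
    ext χ
    exact hφ _
  change ((G.symm (φ.comp e') : S) : H →L[ℂ] H) = A j
  rw [this, StarAlgEquiv.symm_apply_apply]

theorem exists_isBorelCalculus {d : ℕ} (A : Fin d → H →L[ℂ] H)
    (hnormal : ∀ j, IsStarNormal (A j)) (hcomm : ∀ i j, A i * A j = A j * A i) :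
    ∃ Φ : MeasFun (Fin d → ℂ) → ClosedOp H,
      IsBorelCalculus Φ ∧ ∀ j, Φ (coord j) = ofBounded (A j) := by
  obtain ⟨K, hK, ρ, hρ⟩ := exists_representation A hnormal hcomm
  have : CompactSpace K := isCompact_iff_compactSpace.1 hK
  obtain ⟨Φ, hΦ, h⟩ := exists_isMeasurableCalculus ρ (measurable_subtype_coe (p := (· ∈ K)))
  refine ⟨Φ, hΦ, fun j => ?_⟩
  let φ : C(K, ℂ) := ⟨fun k => k.1 j, (continuous_apply j).comp continuous_subtype_val⟩
  rw [h (coord j) φ rfl, hρ j φ fun _ => rfl]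

end Existence

/-! ### Consequences of the calculus axioms. -/

section Bounded

variable {H : Type*} [NormedAddCommGroup H] [InnerProductSpace ℂ H] {T : H →L[ℂ] H}

theorem eq_ofBounded_of_graph {A : ClosedOp H} (h : ∀ x, (x, T x) ∈ A.1.graph) :
    A = ofBounded T := by
  refine ClosedOp.ext_graph fun x y => ?_
  rw [mem_graph_ofBounded]
  exact ⟨fun hy => A.1.mem_graph_snd_inj (h x) hy rfl, fun hy => hy ▸ h x⟩

theorem mem_graph_of_eq_ofBounded {A : ClosedOp H} (h : A = ofBounded T) (x : H) :
    (x, T x) ∈ A.1.graph := by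
  rw [h, mem_graph_ofBounded]

end Bounded

section Calculus

variable {X : Type*} [MeasurableSpace X]
variable {H : Type*} [NormedAddCommGroup H] [InnerProductSpace ℂ H] [CompleteSpace H]
variable {Φ Ψ : MeasFun X → ClosedOp H} {f g : MeasFun X} {x y z : H} {T S : H →L[ℂ] H} {C : ℝ}

/-- A measurable function as an element of `MeasFun X`. -/
def MeasFun.mk (f : X → ℂ) (hf : Measurable f) : MeasFun X := ⟨f, hf⟩

theorem MeasFun.ext {f g : MeasFun X} (h : ∀ a, f.1 a = g.1 a) : f = g :=
  Subtype.ext (funext h)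

namespace IsMeasurableCalculus

theorem mem_graph_add (hΦ : IsMeasurableCalculus Φ) (hf : (x, y) ∈ (Φ f).1.graph)
    (hg : (x, z) ∈ (Φ g).1.graph) : (x, y + z) ∈ (Φ (f + g)).1.graph :=
  LinearPMap.le_graph_of_le (hΦ.add_le f g) (MeasCalc.mem_graph_add.2 ⟨y, z, hf, hg, rfl⟩)

theorem mem_graph_smul (hΦ : IsMeasurableCalculus Φ) (c : ℂ) (hf : (x, y) ∈ (Φ f).1.graph) :
    (x, c • y) ∈ (Φ (c • f)).1.graph :=
  LinearPMap.le_graph_of_le (hΦ.smul_le c f) (MeasCalc.mem_graph_smul.2 ⟨y, hf, rfl⟩)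

theorem mem_graph_mul (hΦ : IsMeasurableCalculus Φ) (hg : (x, z) ∈ (Φ g).1.graph)
    (hf : (z, y) ∈ (Φ f).1.graph) : (x, y) ∈ (Φ (f * g)).1.graph :=
  LinearPMap.le_graph_of_le (hΦ.mul_le f g) (mem_graph_opMul.2 ⟨z, hg, hf⟩)

/-- This is where the domain axiom enters: it allows `Φ g` to be cancelled from `Φ (f * g)`. -/
theorem mem_graph_of_mul (hΦ : IsMeasurableCalculus Φ) (hg : (x, z) ∈ (Φ g).1.graph)
    (hfg : (x, y) ∈ (Φ (f * g)).1.graph) : (z, y) ∈ (Φ f).1.graph := by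
  have hx : x ∈ (opMul (Φ f).1 (Φ g).1).domain := by
    rw [hΦ.mul_domain]
    exact ⟨LinearPMap.mem_domain_iff.2 ⟨z, hg⟩, LinearPMap.mem_domain_iff.2 ⟨y, hfg⟩⟩
  obtain ⟨y', hy'⟩ := LinearPMap.mem_domain_iff.1 hx
  obtain ⟨z', hz', h⟩ := mem_graph_opMul.1 hy'
  rw [(Φ g).1.mem_graph_snd_inj hg hz' rfl,
    (Φ (f * g)).1.mem_graph_snd_inj hfg (hΦ.mem_graph_mul hz' h) rfl]
  exact h

theorem apply_add (hΦ : IsMeasurableCalculus Φ) (hf : Φ f = ofBounded T) (hg : Φ g = ofBounded S) :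
    Φ (f + g) = ofBounded (T + S) :=
  eq_ofBounded_of_graph fun x =>
    hΦ.mem_graph_add (mem_graph_of_eq_ofBounded hf x) (mem_graph_of_eq_ofBounded hg x)

theorem apply_smul (hΦ : IsMeasurableCalculus Φ) (c : ℂ) (hf : Φ f = ofBounded T) :
    Φ (c • f) = ofBounded (c • T) :=
  eq_ofBounded_of_graph fun x => hΦ.mem_graph_smul c (mem_graph_of_eq_ofBounded hf x)

theorem apply_mul (hΦ : IsMeasurableCalculus Φ) (hf : Φ f = ofBounded T) (hg : Φ g = ofBounded S) :
    Φ (f * g) = ofBounded (T * S) :=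
  eq_ofBounded_of_graph fun x =>
    hΦ.mem_graph_mul (mem_graph_of_eq_ofBounded hg x) (mem_graph_of_eq_ofBounded hf (S x))

theorem apply_one (hΦ : IsMeasurableCalculus Φ) : Φ 1 = ofBounded 1 := hΦ.map_one

theorem apply_zero (hΦ : IsMeasurableCalculus Φ) : Φ 0 = ofBounded 0 := by
  simpa using hΦ.apply_smul 0 hΦ.apply_one

theorem apply_sum (hΦ : IsMeasurableCalculus Φ) {ι : Type*} (s : Finset ι) {f : ι → MeasFun X}
    {T : ι → H →L[ℂ] H} (h : ∀ i, Φ (f i) = ofBounded (T i)) :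
    Φ (∑ i ∈ s, f i) = ofBounded (∑ i ∈ s, T i) := by
  classical
  induction s using Finset.induction_on with
  | empty => simpa using hΦ.apply_zero
  | insert i s hi ih =>
    rw [Finset.sum_insert hi, Finset.sum_insert hi]
    exact hΦ.apply_add (h i) ih

theorem exists_eq_ofBounded (hΦ : IsMeasurableCalculus Φ) (hC : ∀ a, ‖f.1 a‖ ≤ C) :
    ∃ T : H →L[ℂ] H, Φ f = ofBounded T :=
  (hΦ.bounded f ⟨C, hC⟩).imp fun _ h => h.1

theorem apply_star (hΦ : IsMeasurableCalculus Φ) (hC : ∀ a, ‖f.1 a‖ ≤ C) (hf : Φ f = ofBounded T) :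
    Φ (star f) = ofBounded (ContinuousLinearMap.adjoint T) := by
  obtain ⟨T', h1, h2⟩ := hΦ.bounded f ⟨C, hC⟩
  rwa [ofBounded_injective (hf.symm.trans h1)]

theorem norm_apply_le (hΦ : IsMeasurableCalculus Φ) (hC : ∀ a, ‖f.1 a‖ ≤ C) (hC0 : 0 ≤ C)
    (hf : Φ f = ofBounded T) (x : H) : ‖T x‖ ≤ C * ‖x‖ := by
  -- With `|h|² + |f|² = C²`, the calculus gives `‖S x‖² + ‖T x‖² = C² ‖x‖²`.
  let h : MeasFun X := MeasFun.mk (fun a => ((√(C ^ 2 - ‖f.1 a‖ ^ 2) : ℝ) : ℂ)) (by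
    have : Measurable f.1 := f.2
    fun_prop)
  have hb : ∀ a, ‖h.1 a‖ ≤ C := fun a => by
    change ‖((√(C ^ 2 - ‖f.1 a‖ ^ 2) : ℝ) : ℂ)‖ ≤ C
    rw [Complex.norm_real, Real.norm_of_nonneg (Real.sqrt_nonneg _)]
    exact Real.sqrt_le_iff.2 ⟨hC0, by nlinarith [sq_nonneg ‖f.1 a‖]⟩
  obtain ⟨S, hS⟩ := hΦ.exists_eq_ofBounded hb
  have hsum : star h * h + star f * f = ((C ^ 2 : ℝ) : ℂ) • (1 : MeasFun X) := by
    refine MeasFun.ext fun a => ?_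
    change star ((√(C ^ 2 - ‖f.1 a‖ ^ 2) : ℝ) : ℂ) * ((√(C ^ 2 - ‖f.1 a‖ ^ 2) : ℝ) : ℂ) +
      star (f.1 a) * f.1 a = ((C ^ 2 : ℝ) : ℂ) * 1
    have h0 : 0 ≤ C ^ 2 - ‖f.1 a‖ ^ 2 := by
      have := pow_le_pow_left₀ (norm_nonneg _) (hC a) 2
      linarith
    simp only [RCLike.star_def]
    rw [Complex.conj_ofReal, ← Complex.ofReal_mul,
      Real.mul_self_sqrt h0, ← Complex.normSq_eq_conj_mul_self, Complex.normSq_eq_norm_sq]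
    push_cast
    ring
  have h1 := hΦ.apply_add (hΦ.apply_mul (hΦ.apply_star hb hS) hS)
    (hΦ.apply_mul (hΦ.apply_star hC hf) hf)
  rw [hsum, hΦ.apply_smul _ hΦ.apply_one] at h1
  have h2 := congrArg (fun L : H →L[ℂ] H => (inner ℂ x (L x)).re) (ofBounded_injective h1)
  simp only [add_apply, mul_apply_eq_comp, smul_apply, inner_add_right, inner_smul_right,
    ContinuousLinearMap.adjoint_inner_right, one_apply_eq_self,
    Complex.add_re, Complex.re_ofReal_mul] at h2
  have h3 : C ^ 2 * ‖x‖ ^ 2 = ‖S x‖ ^ 2 + ‖T x‖ ^ 2 := by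
    have hn : ∀ v : H, (inner ℂ v v).re = ‖v‖ ^ 2 := fun v => inner_self_eq_norm_sq (𝕜 := ℂ) v
    simpa only [hn] using h2
  refine le_of_sq_le_sq ?_ (by positivity)
  nlinarith [sq_nonneg ‖S x‖]

/-- If `Φ g` is bounded then so is `Φ (star g)`, and it is the adjoint, although `g` need not be
bounded. -/
theorem apply_star_of_eq_ofBounded (hΦ : IsMeasurableCalculus Φ) (hg : Φ g = ofBounded T) :
    Φ (star g) = ofBounded (ContinuousLinearMap.adjoint T) := by
  have hgm : Measurable g.1 := g.2
  obtain ⟨R, hR⟩ := exists_nat_gt ‖T‖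
  have hR0 : (0 : ℝ) < R := (norm_nonneg T).trans_lt hR
  let p : MeasFun X := MeasFun.mk (cutoff g.1 R) (measurable_cutoff hgm R)
  -- `t` inverts `g` on `{|g| > R}` and vanishes elsewhere, so `|t| ≤ 1 / R` and `V T = 1 - P`.
  let t : MeasFun X := MeasFun.mk (fun a => (1 - cutoff g.1 R a) / g.1 a)
    ((measurable_const.sub (measurable_cutoff hgm R)).div hgm)
  have hp : ∀ a, p.1 a = cutoff g.1 R a := fun _ => rfl
  have ht : ∀ a, t.1 a = (1 - cutoff g.1 R a) / g.1 a := fun _ => rfl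
  have htb : ∀ a, ‖t.1 a‖ ≤ (R : ℝ)⁻¹ := fun a => by
    rw [ht]
    by_cases h : ‖g.1 a‖ ≤ R
    · simp [cutoff, h]
    · have h' : (1 - cutoff g.1 R a) / g.1 a = (g.1 a)⁻¹ := by simp [cutoff, h]
      rw [h', norm_inv]
      exact inv_anti₀ hR0 (not_le.1 h).le
  obtain ⟨P, hP⟩ := hΦ.exists_eq_ofBounded (f := p) (norm_cutoff_le g.1 R)
  obtain ⟨V, hV⟩ := hΦ.exists_eq_ofBounded htb
  have e1 : t * g + p = 1 := by
    refine MeasFun.ext fun a => ?_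
    change t.1 a * g.1 a + p.1 a = 1
    rw [ht, hp]
    by_cases h : ‖g.1 a‖ ≤ R
    · simp [cutoff, h]
    · have h0 : g.1 a ≠ 0 := fun h0 => h (by simp [h0])
      simp [cutoff, h, h0]
  have e2 : p * p = p := Subtype.ext (cutoff_mul_self g.1 R)
  have h1 : V * T + P = 1 := by
    apply ofBounded_injective
    rw [← hΦ.apply_add (hΦ.apply_mul hV hg) hP, e1, hΦ.apply_one]
  have h2 : P * P = P := by
    apply ofBounded_injective
    rw [← hΦ.apply_mul hP hP, e2, hP]
  -- A vector `w` in the range of `1 - P` satisfies `w = V T w`, so `‖w‖ ≤ (‖T‖ / R) ‖w‖` with `‖T‖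
  -- < R`.
  have hP1 : P = 1 := by
    rw [← sub_eq_zero, ← neg_eq_zero, neg_sub]
    ext v
    set w := (1 - P) v with hw
    have h3 : V (T w) = w := by
      have h4 : V * T * (1 - P) = 1 - P := by
        rw [← eq_sub_iff_add_eq] at h1
        rw [h1, mul_sub, sub_mul 1 P P, h2]
        simp
      exact congrArg (fun L : H →L[ℂ] H => L v) h4
    have h5 : ‖w‖ ≤ (R : ℝ)⁻¹ * (‖T‖ * ‖w‖) :=
      calc ‖w‖ = ‖V (T w)‖ := by rw [h3]
        _ ≤ (R : ℝ)⁻¹ * ‖T w‖ := hΦ.norm_apply_le htb (by positivity) hV _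
        _ ≤ (R : ℝ)⁻¹ * (‖T‖ * ‖w‖) := by gcongr; exact T.le_opNorm w
    by_contra h6
    have h7 : 0 < ‖w‖ := norm_pos_iff.2 h6
    have h8 : (R : ℝ)⁻¹ * (‖T‖ * ‖w‖) < ‖w‖ := by
      rw [inv_mul_lt_iff₀ hR0]
      exact mul_lt_mul_of_pos_right hR h7
    linarith
  have hpg : Φ (p * g) = ofBounded T := by
    simpa [hP1] using hΦ.apply_mul hP hg
  have hst := hΦ.apply_star (f := p * g) (norm_cutoff_mul_le g.1 R) hpg
  have e3 : star (p * g) = star g * p := by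
    rw [star_mul]
    congr 1
    exact Subtype.ext (star_cutoff g.1 R)
  -- The adjoint axiom applies to the bounded function `p * g`; the factor `p` is then cancelled
  -- because `Φ p = 1`.
  refine eq_ofBounded_of_graph fun v => hΦ.mem_graph_of_mul (g := p) (x := v) ?_ ?_
  · rw [hP, mem_graph_ofBounded, hP1]
    rfl
  · rw [← e3, hst, mem_graph_ofBounded]

theorem tendsto_inner (hΦ : IsMeasurableCalculus Φ) {f : ℕ → MeasFun X} {T : ℕ → H →L[ℂ] H}
    (hC : ∀ n a, ‖(f n).1 a‖ ≤ C) (hlim : ∀ a, Tendsto (fun n => (f n).1 a) atTop (𝓝 (g.1 a)))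
    (hT : ∀ n, Φ (f n) = ofBounded (T n)) (hS : Φ g = ofBounded S) (x y : H) :
    Tendsto (fun n => inner ℂ y (T n x)) atTop (𝓝 (inner ℂ y (S x))) := by
  simpa using (hΦ.weak_bp f g ⟨C, hC⟩ hlim T S hT hS x y).star

end IsMeasurableCalculus

end Calculus

/-! ### Scalar measures of a calculus, and reduction to bounded functions. -/

section ScalarMeasure

theorem sum_indicator_of_disjoint {X : Type*} {s : ℕ → Set X}
    (hd : Pairwise (Function.onFun Disjoint s)) {j : ℕ} {a : X} (ha : a ∈ s j) (n : ℕ) :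
    ∑ i ∈ Finset.range n, (s i).indicator (1 : X → ℂ) a = if j < n then 1 else 0 := by
  have : ∀ i, (s i).indicator (1 : X → ℂ) a = if j = i then 1 else 0 := fun i => by
    by_cases h : j = i
    · subst h
      simp [ha]
    · have : a ∉ s i := Set.disjoint_left.1 (hd h) ha
      simp [h, this]
  simp [this]

variable {X : Type*} [MeasurableSpace X]
variable {H : Type*} [NormedAddCommGroup H] [InnerProductSpace ℂ H] [CompleteSpace H]
variable {Φ Ψ : MeasFun X → ClosedOp H} {f g : MeasFun X} {x y z : H} {T S : H →L[ℂ] H} {C : ℝ}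

/-- The indicator function of a measurable set. -/
noncomputable def indicatorFun {s : Set X} (hs : MeasurableSet s) : MeasFun X :=
  MeasFun.mk (s.indicator 1) (measurable_one.indicator hs)

theorem norm_indicatorFun_le {s : Set X} (hs : MeasurableSet s) (a : X) :
    ‖(indicatorFun hs).1 a‖ ≤ 1 := by
  change ‖s.indicator (1 : X → ℂ) a‖ ≤ 1
  by_cases h : a ∈ s <;> simp [h]

namespace IsMeasurableCalculus

theorem inner_indicatorFun (hΦ : IsMeasurableCalculus Φ) {s : Set X} (hs : MeasurableSet s)
    (hT : Φ (indicatorFun hs) = ofBounded T) (x : H) :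
    inner ℂ x (T x) = ((‖T x‖ ^ 2 : ℝ) : ℂ) := by
  have hb := norm_indicatorFun_le hs
  have h1 := hΦ.apply_mul (hΦ.apply_star hb hT) hT
  have h2 : star (indicatorFun hs) * indicatorFun hs = indicatorFun hs := by
    refine MeasFun.ext fun a => ?_
    change star (s.indicator (1 : X → ℂ) a) * s.indicator 1 a = s.indicator 1 a
    by_cases h : a ∈ s <;> simp [h]
  rw [h2, hT] at h1
  nth_rw 1 [ofBounded_injective h1]
  rw [mul_apply_eq_comp, ContinuousLinearMap.adjoint_inner_right, inner_self_eq_norm_sq_to_K]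
  norm_cast

/-- Countable additivity comes from the bounded convergence axiom, applied to partial sums of
indicators of disjoint sets. -/
theorem exists_measure_indicatorFun (hΦ : IsMeasurableCalculus Φ) (x : H) :
    ∃ μ : Measure X, ∀ (s : Set X) (hs : MeasurableSet s) (T : H →L[ℂ] H),
      Φ (indicatorFun hs) = ofBounded T → μ s = ENNReal.ofReal (‖T x‖ ^ 2) := by
  choose P hP using fun (s : Set X) (hs : MeasurableSet s) =>
    hΦ.exists_eq_ofBounded (norm_indicatorFun_le hs)
  refine ⟨Measure.ofMeasurable (fun s hs => ENNReal.ofReal (‖P s hs x‖ ^ 2)) ?_ ?_, ?_⟩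
  · have h0 : indicatorFun (X := X) MeasurableSet.empty = 0 := by
      refine MeasFun.ext fun a => ?_
      change (∅ : Set X).indicator (1 : X → ℂ) a = 0
      simp
    have h1 := hP ∅ MeasurableSet.empty
    rw [h0, hΦ.apply_zero] at h1
    simp [← ofBounded_injective h1]
  · intro s hs hd
    have hsum : ∀ n a, (∑ i ∈ Finset.range n, indicatorFun (hs i)).1 a =
        ∑ i ∈ Finset.range n, (s i).indicator (1 : X → ℂ) a := fun n a => by
      rw [AddSubmonoidClass.coe_finsetSum, Finset.sum_apply]
      rfl
    have hlim := hΦ.tendsto_inner (f := fun n => ∑ i ∈ Finset.range n, indicatorFun (hs i))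
      (g := indicatorFun (MeasurableSet.iUnion hs)) (C := 1) ?_ ?_
      (fun n => hΦ.apply_sum (Finset.range n) fun i => hP (s i) (hs i)) (hP _ _) x x
    · have h1 : Tendsto (fun n => ∑ i ∈ Finset.range n, ‖P (s i) (hs i) x‖ ^ 2) atTop
          (𝓝 (‖P _ (MeasurableSet.iUnion hs) x‖ ^ 2)) := by
        have := (Complex.continuous_re.tendsto _).comp hlim
        simp only [Function.comp_def, sum_apply, inner_sum,
          hΦ.inner_indicatorFun _ (hP _ _), ← Complex.ofReal_sum, Complex.ofReal_re] at this
        exact this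
      have h2 := ENNReal.tendsto_ofReal h1
      simp only [ENNReal.ofReal_sum_of_nonneg fun i _ => sq_nonneg ‖P (s i) (hs i) x‖] at h2
      exact tendsto_nhds_unique h2 ENNReal.summable.hasSum.tendsto_sum_nat
    · intro n a
      rw [hsum]
      by_cases ha : ∃ j, a ∈ s j
      · obtain ⟨j, hj⟩ := ha
        rw [sum_indicator_of_disjoint hd hj]
        split_ifs <;> simp
      · push Not at ha
        simp [ha]
    · intro a
      simp only [hsum]
      change Tendsto _ _ (𝓝 ((⋃ i, s i).indicator (1 : X → ℂ) a))
      by_cases ha : ∃ j, a ∈ s j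
      · obtain ⟨j, hj⟩ := ha
        rw [Set.indicator_of_mem (Set.mem_iUnion.2 ⟨j, hj⟩)]
        refine tendsto_const_nhds.congr' ?_
        filter_upwards [eventually_gt_atTop j] with n hn
        rw [sum_indicator_of_disjoint hd hj, if_pos hn]
        rfl
      · push Not at ha
        simp [ha]
  · intro s hs T hT
    rw [Measure.ofMeasurable_apply s hs, ofBounded_injective (hT.symm.trans (hP s hs))]

/-- The scalar measure of a vector represents the calculus on bounded functions. -/
theorem exists_measure (hΦ : IsMeasurableCalculus Φ) (x : H) :
    ∃ μ : Measure X, IsFiniteMeasure μ ∧ ∀ (f : MeasFun X) (C : ℝ), (∀ a, ‖f.1 a‖ ≤ C) →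
      ∀ T : H →L[ℂ] H, Φ f = ofBounded T → ∫ a, f.1 a ∂μ = inner ℂ x (T x) := by
  obtain ⟨μ, hμ⟩ := hΦ.exists_measure_indicatorFun x
  choose P hP using fun (s : Set X) (hs : MeasurableSet s) =>
    hΦ.exists_eq_ofBounded (norm_indicatorFun_le hs)
  have hfin : IsFiniteMeasure μ :=
    ⟨by rw [hμ _ MeasurableSet.univ _ (hP _ _)]; exact ENNReal.ofReal_lt_top⟩
  refine ⟨μ, hfin, ?_⟩
  have hbdd : ∀ u : SimpleFunc X ℂ, ∃ C : ℝ, ∀ a, ‖u a‖ ≤ C := fun u => by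
    obtain ⟨C, hC⟩ := (u.finite_range.image norm).bddAbove
    exact ⟨C, fun a => hC ⟨u a, ⟨a, rfl⟩, rfl⟩⟩
  have hsimple : ∀ u : SimpleFunc X ℂ, ∀ T : H →L[ℂ] H,
      Φ (MeasFun.mk u u.measurable) = ofBounded T → ∫ a, u a ∂μ = inner ℂ x (T x) := by
    intro u
    induction u using SimpleFunc.induction with
    | const c hs =>
      rename_i s
      intro T hT
      have e : MeasFun.mk _ (SimpleFunc.measurable (SimpleFunc.piecewise s hs
          (SimpleFunc.const X c) (SimpleFunc.const X 0))) = c • indicatorFun hs := by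
        refine MeasFun.ext fun a => ?_
        change _ = c * s.indicator (1 : X → ℂ) a
        by_cases h : a ∈ s <;> simp [MeasFun.mk, h]
      rw [e, hΦ.apply_smul c (hP s hs)] at hT
      rw [← ofBounded_injective hT, smul_apply, inner_smul_right,
        hΦ.inner_indicatorFun hs (hP s hs)]
      have e2 : ∀ a, (SimpleFunc.piecewise s hs (SimpleFunc.const X c) (SimpleFunc.const X 0)) a =
          s.indicator (fun _ => c) a := fun a => by
        by_cases h : a ∈ s <;> simp [h]
      simp only [e2]
      rw [integral_indicator hs, setIntegral_const, Measure.real, hμ s hs _ (hP s hs),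
        ENNReal.toReal_ofReal (by positivity), Complex.real_smul, mul_comm]
    | add hd hu hv =>
      rename_i u v
      intro T hT
      obtain ⟨Cu, hCu⟩ := hbdd u
      obtain ⟨Cv, hCv⟩ := hbdd v
      obtain ⟨U, hU⟩ := hΦ.exists_eq_ofBounded (f := MeasFun.mk u u.measurable) hCu
      obtain ⟨V, hV⟩ := hΦ.exists_eq_ofBounded (f := MeasFun.mk v v.measurable) hCv
      have e : MeasFun.mk _ (u + v).measurable =
          MeasFun.mk u u.measurable + MeasFun.mk v v.measurable := rfl
      rw [e, hΦ.apply_add hU hV] at hT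
      rw [← ofBounded_injective hT, add_apply, inner_add_right, ← hu U hU, ← hv V hV]
      simp only [SimpleFunc.add_apply]
      exact integral_add (u.integrable_of_isFiniteMeasure) (v.integrable_of_isFiniteMeasure)
  intro f C hC T hT
  have hf : StronglyMeasurable f.1 := Measurable.stronglyMeasurable f.2
  -- `C` may be negative when `X` is empty, while the bounded approximation needs a nonnegative
  -- bound.
  have hC' : ∀ a, ‖f.1 a‖ ≤ |C| := fun a => (hC a).trans (le_abs_self C)
  have hb : ∀ n a, ‖hf.approxBounded |C| n a‖ ≤ |C| := fun n a =>
    hf.norm_approxBounded_le (abs_nonneg C) n a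
  have hlim : ∀ a, Tendsto (fun n => hf.approxBounded |C| n a) atTop (𝓝 (f.1 a)) := fun a =>
    hf.tendsto_approxBounded_of_norm_le (hC' a)
  choose U hU using fun n => hΦ.exists_eq_ofBounded
    (f := MeasFun.mk (hf.approxBounded |C| n) (SimpleFunc.measurable _)) (hb n)
  have h1 := hΦ.tendsto_inner (f := fun n => MeasFun.mk (hf.approxBounded |C| n)
    (SimpleFunc.measurable _)) (g := f) hb hlim hU hT x x
  simp only [← hsimple _ _ (hU _)] at h1
  have h2 := tendsto_integral_of_dominated_convergence (μ := μ) (fun _ => |C|)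
    (F := fun n => hf.approxBounded |C| n) (f := f.1)
    (fun n => (SimpleFunc.measurable _).aestronglyMeasurable) (integrable_const _)
    (fun n => ae_of_all _ (hb n)) (ae_of_all _ hlim)
  exact tendsto_nhds_unique h2 h1

/-- With `P n` the projection for `{|f| ≤ n}`, the bounded function `p n * f` maps `x` to `P n y`
under both calculi. Cancelling `p n` puts `(P n x, P n y)` in the graph of `Ψ f`, which is closed.
-/
theorem le_of_eq_on_bounded (hΦ : IsMeasurableCalculus Φ) (hΨ : IsMeasurableCalculus Ψ)
    (h : ∀ (f : MeasFun X) (C : ℝ), (∀ a, ‖f.1 a‖ ≤ C) → Φ f = Ψ f) (f : MeasFun X)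
    (hxy : (x, y) ∈ (Φ f).1.graph) : (x, y) ∈ (Ψ f).1.graph := by
  have hfm : Measurable f.1 := f.2
  let p : ℕ → MeasFun X := fun n => MeasFun.mk (cutoff f.1 n) (measurable_cutoff hfm n)
  have hpb : ∀ n a, ‖(p n).1 a‖ ≤ 1 := norm_cutoff_le f.1
  choose P hP using fun n => hΦ.exists_eq_ofBounded (hpb n)
  have hlim : ∀ v : H, Tendsto (fun n => P n v) atTop (𝓝 v) := by
    intro v
    have h1 := (Complex.continuous_re.tendsto _).comp
      (hΦ.tendsto_inner hpb (g := 1) (tendsto_cutoff f.1) hP hΦ.apply_one v v)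
    -- For these projections weak convergence to the identity upgrades to strong convergence.
    have h2 : ∀ n, ‖v - P n v‖ ^ 2 = ‖v‖ ^ 2 - (inner ℂ v (P n v)).re := fun n => by
      have hs : MeasurableSet {a | ‖f.1 a‖ ≤ n} := measurableSet_le hfm.norm measurable_const
      have h3 := hΦ.inner_indicatorFun hs (hP n) v
      have h4 := norm_sub_sq (𝕜 := ℂ) v (P n v)
      rw [h3] at h4 ⊢
      change _ = ‖v‖ ^ 2 - 2 * ‖P n v‖ ^ 2 + ‖P n v‖ ^ 2 at h4
      rw [Complex.ofReal_re]
      linarith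
    have hv : (inner ℂ v ((1 : H →L[ℂ] H) v)).re = ‖v‖ ^ 2 :=
      inner_self_eq_norm_sq (𝕜 := ℂ) v
    rw [hv] at h1
    have h5 := (h1.const_sub (‖v‖ ^ 2)).sqrt
    simp only [Function.comp_def, ← h2, Real.sqrt_sq (norm_nonneg _), sub_self,
      Real.sqrt_zero] at h5
    rw [tendsto_iff_norm_sub_tendsto_zero]
    simpa only [norm_sub_rev v] using h5
  refine (Ψ f).2.mem_of_tendsto ((hlim x).prodMk_nhds (hlim y)) (Eventually.of_forall fun n => ?_)
  have h1 : (x, P n y) ∈ (Φ (p n * f)).1.graph :=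
    hΦ.mem_graph_mul hxy (mem_graph_of_eq_ofBounded (hP n) y)
  rw [h (p n * f) n (norm_cutoff_mul_le f.1 n), mul_comm] at h1
  refine hΨ.mem_graph_of_mul (g := p n) ?_ h1
  rw [← h (p n) 1 (hpb n)]
  exact mem_graph_of_eq_ofBounded (hP n) x

theorem eq_of_eq_on_bounded (hΦ : IsMeasurableCalculus Φ) (hΨ : IsMeasurableCalculus Ψ)
    (h : ∀ (f : MeasFun X) (C : ℝ), (∀ a, ‖f.1 a‖ ≤ C) → Φ f = Ψ f) : Φ = Ψ :=
  funext fun f => ClosedOp.ext_graph fun _ _ =>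
    ⟨hΦ.le_of_eq_on_bounded hΨ h f,
      hΨ.le_of_eq_on_bounded hΦ (fun f C hC => (h f C hC).symm) f⟩

end IsMeasurableCalculus

end ScalarMeasure

/-! ### Uniqueness from agreement on a point-separating algebra. -/

section Uniqueness

variable {X : Type*} [TopologicalSpace X] [MeasurableSpace X] [BorelSpace X]
variable {H : Type*} [NormedAddCommGroup H] [InnerProductSpace ℂ H] [CompleteSpace H]
variable {Φ Ψ : MeasFun X → ClosedOp H}

/-- A bounded continuous function as a measurable function. -/
noncomputable def boundedContinuousFun (f : X →ᵇ ℂ) : MeasFun X :=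
  MeasFun.mk f f.continuous.measurable

namespace IsMeasurableCalculus

theorem exists_boundedContinuousFun (hΦ : IsMeasurableCalculus Φ) (f : X →ᵇ ℂ) :
    ∃ T : H →L[ℂ] H, Φ (boundedContinuousFun f) = ofBounded T :=
  hΦ.exists_eq_ofBounded f.norm_coe_le_norm

/-- The bounded continuous functions on which two calculi agree. -/
noncomputable def agreement (hΦ : IsMeasurableCalculus Φ) (hΨ : IsMeasurableCalculus Ψ) :
    StarSubalgebra ℂ (X →ᵇ ℂ) where
  carrier := {f | Φ (boundedContinuousFun f) = Ψ (boundedContinuousFun f)}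
  mul_mem' := by
    intro f g (hf : _ = _) (hg : _ = _)
    obtain ⟨T, hT⟩ := hΦ.exists_boundedContinuousFun f
    obtain ⟨S, hS⟩ := hΦ.exists_boundedContinuousFun g
    exact (hΦ.apply_mul hT hS).trans (hΨ.apply_mul (hf ▸ hT) (hg ▸ hS)).symm
  add_mem' := by
    intro f g (hf : _ = _) (hg : _ = _)
    obtain ⟨T, hT⟩ := hΦ.exists_boundedContinuousFun f
    obtain ⟨S, hS⟩ := hΦ.exists_boundedContinuousFun g
    exact (hΦ.apply_add hT hS).trans (hΨ.apply_add (hf ▸ hT) (hg ▸ hS)).symm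
  algebraMap_mem' c := by
    have e : boundedContinuousFun (algebraMap ℂ (X →ᵇ ℂ) c) = c • (1 : MeasFun X) := by
      refine MeasFun.ext fun a => ?_
      change (algebraMap ℂ (X →ᵇ ℂ) c) a = c * 1
      simp
    change Φ _ = Ψ _
    rw [e, hΦ.apply_smul c hΦ.apply_one, hΨ.apply_smul c hΨ.apply_one]
  star_mem' := by
    intro f (hf : _ = _)
    obtain ⟨T, hT⟩ := hΦ.exists_boundedContinuousFun f
    exact (hΦ.apply_star f.norm_coe_le_norm hT).trans
      (hΨ.apply_star f.norm_coe_le_norm (hf ▸ hT)).symm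

/-- On a Polish space a finite measure is determined by a point-separating star subalgebra of
bounded continuous functions. So the scalar measures agree, and over `ℂ` the quadratic form
determines the operator. -/
theorem eq_of_separatesPoints [PolishSpace X] (hΦ : IsMeasurableCalculus Φ)
    (hΨ : IsMeasurableCalculus Ψ)
    (hsep : ((hΦ.agreement hΨ).map
      (BoundedContinuousFunction.toContinuousMapStarₐ ℂ)).SeparatesPoints) : Φ = Ψ := by
  refine hΦ.eq_of_eq_on_bounded hΨ fun f C hC => ?_
  obtain ⟨T, hT⟩ := hΦ.exists_eq_ofBounded hC
  obtain ⟨S, hS⟩ := hΨ.exists_eq_ofBounded hC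
  rw [hT, hS]
  congr 1
  suffices (T : H →ₗ[ℂ] H) = S from ContinuousLinearMap.coe_inj.1 this
  rw [← ext_inner_map]
  intro x
  obtain ⟨μ, hμ, h1⟩ := hΦ.exists_measure x
  obtain ⟨ν, hν, h2⟩ := hΨ.exists_measure x
  have hμν : μ = ν := by
    refine ext_of_forall_mem_subalgebra_integral_eq_of_polish hsep fun g hg => ?_
    obtain ⟨U, hU⟩ := hΦ.exists_boundedContinuousFun g
    have hU' : Ψ (boundedContinuousFun g) = ofBounded U := by
      rw [← hU]
      exact Eq.symm hg
    exact (h1 (boundedContinuousFun g) _ g.norm_coe_le_norm U hU).trans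
      (h2 (boundedContinuousFun g) _ g.norm_coe_le_norm U hU').symm
  have h3 : inner ℂ x (T x) = inner ℂ x (S x) := by
    rw [← h1 f C hC T hT, ← h2 f C hC S hS, hμν]
  simpa using congrArg (starRingEnd ℂ) h3

end IsMeasurableCalculus

end Uniqueness

/-! ### Bounded functions of the coordinates, and uniqueness on `ℂ^d`. -/

section Coordinates

variable {H : Type*} [NormedAddCommGroup H] [InnerProductSpace ℂ H] [CompleteSpace H]

/-- The function `1 / (1 + |z j| ^ 2)`. -/
noncomputable def invOneAddSq {d : ℕ} (j : Fin d) : (Fin d → ℂ) →ᵇ ℂ :=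
  BoundedContinuousFunction.ofNormedAddCommGroup (fun z => ((1 + ‖z j‖ ^ 2 : ℝ) : ℂ)⁻¹)
    (by
      refine Continuous.inv₀ (by fun_prop) fun z => ?_
      have : (0 : ℝ) < 1 + ‖z j‖ ^ 2 := by positivity
      exact_mod_cast this.ne')
    1 (fun z => by
      rw [norm_inv, Complex.norm_real, Real.norm_of_nonneg (by positivity)]
      exact inv_le_one_of_one_le₀ (by nlinarith [sq_nonneg ‖z j‖]))

/-- The function `z j / (1 + |z j| ^ 2)`. -/
noncomputable def coordMulInv {d : ℕ} (j : Fin d) : (Fin d → ℂ) →ᵇ ℂ :=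
  BoundedContinuousFunction.ofNormedAddCommGroup (fun z => z j * invOneAddSq j z)
    ((continuous_apply j).mul (invOneAddSq j).continuous)
    1 (fun z => by
      change ‖z j * ((1 + ‖z j‖ ^ 2 : ℝ) : ℂ)⁻¹‖ ≤ 1
      have h : (0 : ℝ) < 1 + ‖z j‖ ^ 2 := by positivity
      rw [norm_mul, norm_inv, Complex.norm_real, Real.norm_of_nonneg h.le, ← div_eq_mul_inv,
        div_le_one h]
      nlinarith [sq_nonneg (‖z j‖ - 1), norm_nonneg (z j)])

theorem invOneAddSq_mul {d : ℕ} (j : Fin d) :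
    boundedContinuousFun (invOneAddSq j) * (1 + star (coord j) * coord j) = 1 := by
  refine MeasFun.ext fun z => ?_
  change ((1 + ‖z j‖ ^ 2 : ℝ) : ℂ)⁻¹ * (1 + star (z j) * z j) = 1
  have h : (0 : ℝ) < 1 + ‖z j‖ ^ 2 := by positivity
  have h' : (1 + star (z j) * z j) = ((1 + ‖z j‖ ^ 2 : ℝ) : ℂ) := by
    rw [RCLike.star_def, ← Complex.normSq_eq_conj_mul_self, Complex.normSq_eq_norm_sq]
    push_cast
    rfl
  rw [h', inv_mul_cancel₀]
  exact_mod_cast h.ne'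

/-- `W` is a two-sided inverse of an operator built from `A` alone, so it does not depend on the
calculus. -/
theorem IsMeasurableCalculus.apply_invOneAddSq {d : ℕ} {Φ : MeasFun (Fin d → ℂ) → ClosedOp H}
    (hΦ : IsMeasurableCalculus Φ) {j : Fin d} {A W : H →L[ℂ] H} (hA : Φ (coord j) = ofBounded A)
    (hW : Φ (boundedContinuousFun (invOneAddSq j)) = ofBounded W) :
    W * (1 + ContinuousLinearMap.adjoint A * A) = 1 ∧
      (1 + ContinuousLinearMap.adjoint A * A) * W = 1 := by
  have hD := hΦ.apply_add hΦ.apply_one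
    (hΦ.apply_mul (hΦ.apply_star_of_eq_ofBounded hA) hA)
  constructor <;> apply ofBounded_injective
  · rw [← hΦ.apply_mul hW hD, invOneAddSq_mul, hΦ.apply_one]
  · rw [← hΦ.apply_mul hD hW, mul_comm, invOneAddSq_mul, hΦ.apply_one]

theorem eq_of_coord_eq {d : ℕ} {Φ Ψ : MeasFun (Fin d → ℂ) → ClosedOp H}
    (hΦ : IsMeasurableCalculus Φ) (hΨ : IsMeasurableCalculus Ψ) (A : Fin d → H →L[ℂ] H)
    (hΦA : ∀ j, Φ (coord j) = ofBounded (A j)) (hΨA : ∀ j, Ψ (coord j) = ofBounded (A j)) :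
    Φ = Ψ := by
  have hinv : ∀ j, invOneAddSq j ∈ hΦ.agreement hΨ := fun j => by
    obtain ⟨W, hW⟩ := hΦ.exists_boundedContinuousFun (invOneAddSq j)
    obtain ⟨V, hV⟩ := hΨ.exists_boundedContinuousFun (invOneAddSq j)
    change Φ _ = Ψ _
    rw [hW, hV, left_inv_eq_right_inv (hΦ.apply_invOneAddSq (hΦA j) hW).1
      (hΨ.apply_invOneAddSq (hΨA j) hV).2]
  have hmul : ∀ j, coordMulInv j ∈ hΦ.agreement hΨ := fun j => by
    obtain ⟨W, hW⟩ := hΦ.exists_boundedContinuousFun (invOneAddSq j)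
    have hW' : Ψ (boundedContinuousFun (invOneAddSq j)) = ofBounded W := by
      rw [← hW]
      exact Eq.symm (hinv j)
    exact (hΦ.apply_mul (hΦA j) hW).trans (hΨ.apply_mul (hΨA j) hW').symm
  refine hΦ.eq_of_separatesPoints hΨ fun z w hzw => ?_
  by_contra hcon
  have heq : ∀ f ∈ hΦ.agreement hΨ, f z = f w := fun f hf => by
    by_contra hne
    exact hcon ⟨f, ⟨f.toContinuousMap, ⟨f, hf, rfl⟩, rfl⟩, hne⟩
  refine hzw (funext fun j => ?_)
  have h1 := heq _ (hinv j)
  have h2 : z j * invOneAddSq j z = w j * invOneAddSq j w := heq _ (hmul j)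
  -- Equal values of `1 / (1 + |z_j|²)` turn equality of `z_j / (1 + |z_j|²)` into equality of
  -- `z_j`, after cancelling a nonzero factor.
  rw [← h1] at h2
  refine mul_right_cancel₀ ?_ h2
  change ((1 + ‖z j‖ ^ 2 : ℝ) : ℂ)⁻¹ ≠ 0
  have h : (0 : ℝ) < 1 + ‖z j‖ ^ 2 := by positivity
  exact inv_ne_zero (by exact_mod_cast h.ne')

end Coordinates

end MeasCalc

theorem mainTheorem2 {H : Type*} [NormedAddCommGroup H] [InnerProductSpace ℂ H] [CompleteSpace H]
    (d : ℕ) (A : Fin d → H →L[ℂ] H) (hnormal : ∀ j, IsStarNormal (A j))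
    (hcomm : ∀ i j, A i * A j = A j * A i) :
    ∃! Φ : MeasCalc.MeasFun (Fin d → ℂ) → MeasCalc.ClosedOp H,
      MeasCalc.IsBorelCalculus Φ ∧ ∀ j, Φ (MeasCalc.coord j) = MeasCalc.ofBounded (A j) := by
  obtain ⟨Φ, hΦ, hA⟩ := MeasCalc.exists_isBorelCalculus A hnormal hcomm
  exact ⟨Φ, ⟨hΦ, hA⟩, fun Ψ hΨ => MeasCalc.eq_of_coord_eq hΨ.1 hΦ A hΨ.2 hA⟩
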